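/- **Theorem (Soundness of mover logic).** Let $\vdash\Sigma$ be the verification judgment for program states defined below, relative to a declaration table $D$ and a mover specification $M$. If $\vdash\Sigma$, then no execution of $\Sigma$ under the preemptive semantics $\to$ reaches a wrong state. **Language.** Let $\mathit{Tid}=\{1,2,\dots\}$. A store is a function $\sigma:\mathit{Var}\to\mathit{Value}$. An action is a set $A\subseteq\mathit{Tid}\times\mathit{Store}\times\mathit{Store}$; it is *total* if for all $t,\sigma$ there is $\sigma'$ with $(t,\sigma,\sigma')\in A$. A conditional action $C=A_1\diamond A_2$ is a pair of actions with $A_1\cup A_2$ total. Statements are $$s ::= \mathtt{skip}\mid\mathtt{wrong}\mid A\mid s;s\mid \mathtt{if}\ C\ s\ \mathtt{else}\ s\mid\mathtt{while}\ C\ s\mid f()\mid\mathtt{yield}.$$ $D$ is a finite table of function declarations $\mathit{spec}\ f()\{s\}$ with distinct names, where $\mathit{spec}$ is either "$\mathbf{atomic}\ e\ \mathbf{requires}\ S\ \mathbf{ensures}\ Q$" or "$\mathbf{relies}\ R\ \mathbf{guarantees}\ G\ \mathbf{requires}\ S\ \mathbf{ensures}\ T$", with $S,T\subseteq\mathit{Tid}\times\mathit{Store}$,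 $Q,R,G\subseteq\mathit{Tid}\times\mathit{Store}\times\mathit{Store}$ and $e$ an effect. Evaluation contexts are $E::=\bullet\mid E;s$. Thread $t$ steps by - $E[\mathtt{skip};s]\cdot\sigma\to_t E[s]\cdot\sigma$; - $E[\mathtt{yield}]\cdot\sigma\to_t E[\mathtt{skip}]\cdot\sigma$; - $E[A]\cdot\sigma\to_t E[\mathtt{skip}]\cdot\sigma'$ if $(t,\sigma,\sigma')\in A$; - $E[\mathtt{if}\,(A_1\diamond A_2)\,s_1\,\mathtt{else}\,s_2]\cdot\sigma\to_t E[s_i]\cdot\sigma'$ if $(t,\sigma,\sigma')\in A_i$, $i\in\{1,2\}$; - $E[\mathtt{while}\,C\,s]\cdot\sigma\to_t E[\mathtt{if}\,C\,(s;\mathtt{while}\,C\,s)\,\mathtt{else}\,\mathtt{skip}]\cdot\sigma$; - $E[f()]\cdot\sigma\to_t E[s]\cdot\sigma$ if $f()\{s\}$ is declared in $D$. A state $\Sigma=s_1..s_n\cdot\sigma$ steps, $\Sigma\to\Sigma'$, when any one thread $t\in\{1,\dots,n\}$ replaces $s_t\cdot\sigma$ by $s_t'\cdot\sigma'$ with $s_t\cdot\sigma\to_t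 s_t'\cdot\sigma'$. $\Sigma$ is *wrong* if some $s_t=E[\mathtt{wrong}]$. **Effects.** The effects $\mathsf{Y},\mathsf{R},\mathsf{L},\mathsf{B},\mathsf{N},\mathsf{E}$ (yield, right, left, both, non mover, error) are ordered by $\mathsf Y\sqsubseteq\mathsf B\sqsubseteq\mathsf R,\mathsf L\sqsubseteq\mathsf N\sqsubseteq\mathsf E$, with join $\sqcup$. Sequential composition $e_1;e_2$ (row $e_1$, column $e_2$) and closure $e^*$ are $$\begin{array}{c|cccccc|c} ;&\mathsf Y&\mathsf B&\mathsf R&\mathsf L&\mathsf N&\mathsf E&e^*\\\hline \mathsf Y&\mathsf Y&\mathsf Y&\mathsf Y&\mathsf L&\mathsf L&\mathsf E&\mathsf Y\\ \mathsf B&\mathsf Y&\mathsf B&\mathsf R&\mathsf L&\mathsf N&\mathsf E&\mathsf B\\ \mathsf R&\mathsf R&\mathsf R&\mathsf R&\mathsf N&\mathsf N&\mathsf E&\mathsf R\\ \mathsf L&\mathsf Y&\mathsf L&\mathsf E&\mathsf L&\mathsf E&\mathsf E&\mathsf L\\ \mathsf N&\mathsf R&\mathsf N&\mathsf E&\mathsf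 N&\mathsf E&\mathsf E&\mathsf E\\ \mathsf E&\mathsf E&\mathsf E&\mathsf E&\mathsf E&\mathsf E&\mathsf E&\mathsf E\end{array}$$ **Mover specifications.** $M$ maps each action, thread and store to an effect $M(A,t,\sigma)\neq\mathsf Y$; put $M(A,P)=\bigsqcup_{(t,\_,\sigma)\in P}M(A,t,\sigma)$. $M$ is *valid* if for all threads $t\neq u$, all actions $A_1,A_2$ and all stores $\sigma,\sigma',\sigma''$: 1. if $M(A_1,t,\sigma)\sqsubseteq\mathsf R$, $(t,\sigma,\sigma')\in A_1$, $M(A_2,u,\sigma')\sqsubseteq\mathsf N$ and $(u,\sigma',\sigma'')\in A_2$, then there is $\sigma'''$ with $(u,\sigma,\sigma''')\in A_2$ and $(t,\sigma''',\sigma'')\in A_1$; 2. if $M(A_1,t,\sigma)\sqsubseteq\mathsf N$, $(t,\sigma,\sigma')\in A_1$, $M(A_2,u,\sigma')\sqsubseteq\mathsf L$ and $(u,\sigma',\sigma'')\in A_2$, then there is $\sigma'''$ with $(u,\sigma,\sigma''')\in A_2$ and $(t,\sigma''',\sigma'')\in A_1$; 3. if $M(A_1,t,\sigma)\sqsubseteq\mathsf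 N$ and $(t,\sigma,\sigma')\in A_1$, then $M(A_2,u,\sigma')=M(A_2,u,\sigma)$; 4. if $M(A_1,t,\sigma)\sqsubseteq\mathsf N$, $(t,\sigma,\sigma')\in A_1$, $M(A_2,u,\sigma)\sqsubseteq\mathsf L$ and $(u,\sigma,\sigma'')\in A_2$, then there is $\sigma'''$ with $(u,\sigma',\sigma''')\in A_2$ and $(t,\sigma'',\sigma''')\in A_1$. **Statement judgment.** Write $I=\{(t,\sigma,\sigma)\}$, $\mathit{Two}(S)=\{(t,\sigma,\sigma)\mid(t,\sigma)\in S\}$, $\mathit{Post}(P)=\{(t,\sigma)\mid(t,\_,\sigma)\in P\}$, $P;A=\{(t,\sigma,\sigma'')\mid\exists\sigma'.\,(t,\sigma,\sigma')\in P,\ (t,\sigma',\sigma'')\in A\}$, and $\mathit{Yield}(P,R)=\{(t,\sigma',\sigma')\mid\exists\sigma.\,(t,\_,\sigma)\in P,\ (t,\sigma,\sigma')\in R^*\}$, where $R^*$ is the reflexive-transitive closure for each fixed $t$; $\Rightarrow$ denotes inclusion. The judgment $R;G\vdash s:P\to Q\cdot e$ is the least relation such that - $R;G\vdash A:P\to(P;A)\cdot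 M(A,P)$ if $M(A,P)\sqsubseteq\mathsf L$ implies that $A$ is total; - $R;G\vdash s_1;s_2:P\to Q_2\cdot(e_1;e_2)$ if $R;G\vdash s_1:P\to Q_1\cdot e_1$ and $R;G\vdash s_2:Q_1\to Q_2\cdot e_2$; - $R;G\vdash\mathtt{if}\,(A_1\diamond A_2)\,s_1\,\mathtt{else}\,s_2:P\to Q\cdot(M(A_1,P);e_1)\sqcup(M(A_2,P);e_2)$ if $R;G\vdash s_i:(P;A_i)\to Q\cdot e_i$ for $i=1,2$; - $R;G\vdash\mathtt{while}\,(A_1\diamond A_2)\,s:P\to(P;A_2)\cdot e$ if $R;G\vdash s:(P;A_1)\to P\cdot e_1$, $e=(M(A_1,P);e_1)^*;M(A_2,P)$ and $e\not\sqsubseteq\mathsf L$; - $R;G\vdash\mathtt{skip}:P\to P\cdot\mathsf B$, and $R;G\vdash\mathtt{wrong}:\emptyset\to\emptyset\cdot\mathsf B$; - $R;G\vdash\mathtt{yield}:P\to\mathit{Yield}(P,R)\cdot\mathsf Y$ if $P\Rightarrow G$; - $R;G\vdash s:P\to Q\cdot e$ if $R_1;G_1\vdash s:P_1\to Q_1\cdot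 e_1$, $P\Rightarrow P_1$, $Q_1\Rightarrow Q$, $R\Rightarrow R_1$, $G_1\Rightarrow G$ and $e_1\sqsubseteq e$; - $R;G\vdash f():P\to(P;Q)\cdot e$ if $f$ is declared in $D$ as $\mathbf{atomic}\ e\ \mathbf{requires}\ S\ \mathbf{ensures}\ Q$ and $\mathit{Post}(P)\Rightarrow S$; - $R;G\vdash f():\mathit{Two}(S)\to\mathit{Two}(T)\cdot\mathsf R$ if $f$ is declared in $D$ as $\mathbf{relies}\ R\ \mathbf{guarantees}\ G\ \mathbf{requires}\ S\ \mathbf{ensures}\ T$. **Functions and states.** A declaration of $f$ with body $s$ is *verified* if either its specification is $\mathbf{atomic}\ e\ \mathbf{requires}\ S\ \mathbf{ensures}\ Q$, $f$ is not directly or indirectly recursive, and $\emptyset;\emptyset\vdash s:\mathit{Two}(S)\to Q\cdot e$; or its specification is $\mathbf{relies}\ R\ \mathbf{guarantees}\ G\ \mathbf{requires}\ S\ \mathbf{ensures}\ T$, $R;G\vdash s:\mathit{Two}(S)\to\mathit{Two}(T)\cdot\mathsf R$, and $G\neq\emptyset$. Finally, $\vdash s_1..s_n\cdot\sigma$ holds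 if every declaration in $D$ is verified, $M$ is valid, and there are $R,G$ and, for each thread $t\in\{1,\dots,n\}$, $P_t,Q_t,e_t$ such that $I\Rightarrow G$; for each thread $t$, $R;G\vdash s_t:P_t\to Q_t\cdot e_t$, $e_t\neq\mathsf E$, $Q_t\Rightarrow G$, $s_t$ is yielding (that is, $s_t=E[\mathtt{yield}]$ for some $E$) and $(t,\sigma,\sigma)\in P_t$; and for all threads $t\neq u$ and stores $\sigma_1,\sigma_2$, $(t,\sigma_1,\sigma_2)\in G$ implies $(u,\sigma_1,\sigma_2)\in R$. -/

import Mathlib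

namespace MoverLogic

/-! Effects -/

/-- Effects: yield, right mover, left mover, both mover, non mover, error. -/
inductive Effect : Type
  | Y | R | L | B | N | E
  deriving DecidableEq

namespace Effect

instance : Fintype Effect := ⟨{Y, R, L, B, N, E}, fun x => by cases x <;> decide⟩

/-- The order `Y ⊑ B ⊑ R, L ⊑ N ⊑ E`. -/
def le : Effect → Effect → Prop
  | Y, _ => True
  | B, Y => False
  | B, _ => True
  | R, R => True
  | R, N => True
  | R, E => True
  | R, _ => False
  | L, L => True
  | L, N => True
  | L, E => True
  | L, _ => False
  | N, N => True
  | N, E => True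
  | N, _ => False
  | E, E => True
  | E, _ => False

instance : LE Effect := ⟨le⟩

instance : DecidableRel (fun a b : Effect => a ≤ b) := fun a b => by
  change Decidable (le a b)
  cases a <;> cases b <;> (unfold le; infer_instance)

instance : PartialOrder Effect where
  le_refl := by decide
  le_trans := by decide
  le_antisymm := by decide

/-- Least upper bound of two effects. -/
def join : Effect → Effect → Effect
  | Y, e => e
  | e, Y => e
  | B, e => e
  | e, B => e
  | R, R => R
  | L, L => L
  | E, _ => E
  | _, E => E
  | _, _ => N

/-- Greatest lower bound of two effects. -/
def meet : Effect → Effect → Effect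
  | E, e => e
  | e, E => e
  | N, e => e
  | e, N => e
  | R, R => R
  | L, L => L
  | Y, _ => Y
  | _, Y => Y
  | _, _ => B

instance : Lattice Effect where
  sup := join
  inf := meet
  le_sup_left := by decide
  le_sup_right := by decide
  sup_le := by decide
  inf_le_left := by decide
  inf_le_right := by decide
  le_inf := by decide

instance : BoundedOrder Effect where
  top := E
  bot := Y
  le_top := by decide
  bot_le := by decide

noncomputable instance : CompleteLattice Effect := Fintype.toCompleteLattice Effect

/-- Sequential composition `e₁ ; e₂`. -/
def seq : Effect → Effect → Effect
  | Y, Y => Y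
  | Y, B => Y
  | Y, R => Y
  | Y, L => L
  | Y, N => L
  | Y, E => E
  | B, e => e
  | R, Y => R
  | R, B => R
  | R, R => R
  | R, L => N
  | R, N => N
  | R, E => E
  | L, Y => Y
  | L, B => L
  | L, R => E
  | L, L => L
  | L, N => E
  | L, E => E
  | N, Y => R
  | N, B => N
  | N, R => E
  | N, L => N
  | N, N => E
  | N, E => E
  | E, _ => E

/-- Iterative closure `e*`. -/
def star : Effect → Effect
  | Y => Y
  | B => B
  | R => R
  | L => L
  | N => E
  | E => E

end Effect

/-! Stores, actions, statements, declarations -/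

/-- Thread identifiers `1, 2, …`. -/
abbrev Tid : Type := ℕ+

/-- Stores map variables to values. -/
abbrev Store (Var Val : Type*) := Var → Val

/-- One-store predicates `S, T ⊆ Tid × Store`. -/
abbrev Pred1 (Var Val : Type*) := Set (Tid × Store Var Val)

/-- Two-store predicates `R, G, P, Q ⊆ Tid × Store × Store`, which are also the actions `A`. -/
abbrev Pred2 (Var Val : Type*) := Set (Tid × Store Var Val × Store Var Val)

/-- Every thread can perform the action from every store. -/
def Total {Var Val : Type*} (A : Pred2 Var Val) : Prop :=
  ∀ (t : Tid) (σ : Store Var Val), ∃ σ' : Store Var Val, (t, σ, σ') ∈ A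

/-- Conditional actions `A₁ ⋄ A₂`; at least one of the two cases is always enabled. -/
structure CondAction (Var Val : Type*) where
  onTrue : Pred2 Var Val
  onFalse : Pred2 Var Val
  total : Total (onTrue ∪ onFalse)

/-- Statements, over function names `F`. -/
inductive Stmt (F Var Val : Type*)
  | skip : Stmt F Var Val
  | wrong : Stmt F Var Val
  | action (A : Pred2 Var Val) : Stmt F Var Val
  | seq (s₁ s₂ : Stmt F Var Val) : Stmt F Var Val
  | ite (C : CondAction Var Val) (s₁ s₂ : Stmt F Var Val) : Stmt F Var Val
  | while (C : CondAction Var Val) (s : Stmt F Var Val) : Stmt F Var Val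
  | call (f : F) : Stmt F Var Val
  | yield : Stmt F Var Val

/-- The set of functions that a statement calls. -/
def Stmt.callees {F Var Val : Type*} : Stmt F Var Val → Set F
  | .skip => ∅
  | .wrong => ∅
  | .action _ => ∅
  | .seq s₁ s₂ => s₁.callees ∪ s₂.callees
  | .ite _ s₁ s₂ => s₁.callees ∪ s₂.callees
  | .while _ s => s.callees
  | .call f => {f}
  | .yield => ∅

/-- Function specifications. -/
inductive FnSpec (Var Val : Type*)
  /-- `atomic e requires S ensures Q` -/
  | atomic (e : Effect) (S : Pred1 Var Val) (Q : Pred2 Var Val) : FnSpec Var Val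
  /-- `relies R guarantees G requires S ensures T` -/
  | nonAtomic (R G : Pred2 Var Val) (S T : Pred1 Var Val) : FnSpec Var Val

/-- Function declarations `spec f() { body }`. -/
structure FnDecl (F Var Val : Type*) where
  spec : FnSpec Var Val
  name : F
  body : Stmt F Var Val

/-- Declaration tables: a finite list of function declarations, each function declared at most
once. -/
structure DeclTable (F Var Val : Type*) where
  fns : List (FnDecl F Var Val)
  nodup : (fns.map FnDecl.name).Nodup

/-! Standard preemptive semantics -/

/-- Evaluation contexts `E ::= • | E; s`. -/
inductive Ctx (F Var Val : Type*)
  | hole : Ctx F Var Val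
  | seq (E : Ctx F Var Val) (s : Stmt F Var Val) : Ctx F Var Val

/-- `E[s]`. -/
def Ctx.fill {F Var Val : Type*} : Ctx F Var Val → Stmt F Var Val → Stmt F Var Val
  | .hole, s => s
  | .seq E s', s => .seq (E.fill s) s'

/-- `s · σ →ₜ s' · σ'`. -/
inductive ThreadStep {F Var Val : Type*} (D : DeclTable F Var Val) (t : Tid) :
    Stmt F Var Val → Store Var Val → Stmt F Var Val → Store Var Val → Prop
  | seq (E : Ctx F Var Val) (s : Stmt F Var Val) (σ : Store Var Val) :
      ThreadStep D t (E.fill (.seq .skip s)) σ (E.fill s) σ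
  | yield (E : Ctx F Var Val) (σ : Store Var Val) :
      ThreadStep D t (E.fill .yield) σ (E.fill .skip) σ
  | action (E : Ctx F Var Val) (A : Pred2 Var Val) (σ σ' : Store Var Val)
      (h : (t, σ, σ') ∈ A) :
      ThreadStep D t (E.fill (.action A)) σ (E.fill .skip) σ'
  | iteTrue (E : Ctx F Var Val) (C : CondAction Var Val) (s₁ s₂ : Stmt F Var Val)
      (σ σ' : Store Var Val) (h : (t, σ, σ') ∈ C.onTrue) :
      ThreadStep D t (E.fill (.ite C s₁ s₂)) σ (E.fill s₁) σ'
  | iteFalse (E : Ctx F Var Val) (C : CondAction Var Val) (s₁ s₂ : Stmt F Var Val)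
      (σ σ' : Store Var Val) (h : (t, σ, σ') ∈ C.onFalse) :
      ThreadStep D t (E.fill (.ite C s₁ s₂)) σ (E.fill s₂) σ'
  | while (E : Ctx F Var Val) (C : CondAction Var Val) (s : Stmt F Var Val)
      (σ : Store Var Val) :
      ThreadStep D t (E.fill (.while C s)) σ
        (E.fill (.ite C (.seq s (.while C s)) .skip)) σ
  | call (E : Ctx F Var Val) (fn : FnDecl F Var Val) (σ : Store Var Val) (h : fn ∈ D.fns) :
      ThreadStep D t (E.fill (.call fn.name)) σ (E.fill fn.body) σ

/-- States `s₁..sₙ · σ`; the thread at index `i : Fin n` has identifier `i + 1`. -/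
structure State (F Var Val : Type*) (n : ℕ) where
  threads : Fin n → Stmt F Var Val
  store : Store Var Val

/-- The thread identifier in `{1, …, n}` at index `i`. -/
def tid {n : ℕ} (i : Fin n) : Tid := Nat.succPNat i

/-- `Σ → Σ'`: any one thread takes a step. -/
inductive Step {F Var Val : Type*} {n : ℕ} (D : DeclTable F Var Val) :
    State F Var Val n → State F Var Val n → Prop
  | thread (X : State F Var Val n) (i : Fin n) (s' : Stmt F Var Val) (σ' : Store Var Val)
      (h : ThreadStep D (tid i) (X.threads i) X.store s' σ') :
      Step D X ⟨Function.update X.threads i s', σ'⟩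

/-- Some thread is about to execute `wrong`. -/
def State.IsWrong {F Var Val : Type*} {n : ℕ} (X : State F Var Val n) : Prop :=
  ∃ (i : Fin n) (E : Ctx F Var Val), X.threads i = E.fill .wrong

/-- Some execution from the state reaches a wrong state. -/
def GoesWrong {F Var Val : Type*} {n : ℕ} (D : DeclTable F Var Val)
    (X : State F Var Val n) : Prop :=
  ∃ X₁ : State F Var Val n, Relation.ReflTransGen (Step D) X X₁ ∧ X₁.IsWrong

/-! Mover specifications -/

/-- Mover specifications `M : Action × Tid × Store → Effect \ {Y}`. -/
abbrev MoverSpec (Var Val : Type*) :=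
  Pred2 Var Val → Tid → Store Var Val → {e : Effect // e ≠ Effect.Y}

/-- `M(A, P)`, the join of all `M(A, t, σ)` with `(t, _, σ) ∈ P`. -/
noncomputable def MoverSpec.on {Var Val : Type*} (M : MoverSpec Var Val) (A P : Pred2 Var Val) :
    Effect :=
  sSup {e | ∃ (t : Tid) (σ₀ σ : Store Var Val), (t, σ₀, σ) ∈ P ∧ e = (M A t σ).1}

/-- Validity of a mover specification. -/
structure MoverSpec.Valid {Var Val : Type*} (M : MoverSpec Var Val) : Prop where
  /-- Right movers can be moved later. -/
  right : ∀ (t u : Tid), t ≠ u → ∀ (A₁ A₂ : Pred2 Var Val) (σ σ' σ'' : Store Var Val),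
    (M A₁ t σ).1 ≤ Effect.R → (t, σ, σ') ∈ A₁ →
    (M A₂ u σ').1 ≤ Effect.N → (u, σ', σ'') ∈ A₂ →
    ∃ σ''' : Store Var Val, (u, σ, σ''') ∈ A₂ ∧ (t, σ''', σ'') ∈ A₁
  /-- Left movers can be moved earlier. -/
  left : ∀ (t u : Tid), t ≠ u → ∀ (A₁ A₂ : Pred2 Var Val) (σ σ' σ'' : Store Var Val),
    (M A₁ t σ).1 ≤ Effect.N → (t, σ, σ') ∈ A₁ →
    (M A₂ u σ').1 ≤ Effect.L → (u, σ', σ'') ∈ A₂ →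
    ∃ σ''' : Store Var Val, (u, σ, σ''') ∈ A₂ ∧ (t, σ''', σ'') ∈ A₁
  /-- A step of one thread does not change the effect of an action of another thread. -/
  stable : ∀ (t u : Tid), t ≠ u → ∀ (A₁ A₂ : Pred2 Var Val) (σ σ' : Store Var Val),
    (M A₁ t σ).1 ≤ Effect.N → (t, σ, σ') ∈ A₁ →
    ∀ e : Effect, (M A₂ u σ).1 = e → (M A₂ u σ').1 = e
  /-- A step of one thread does not block a left mover of another thread. -/
  nonblocking : ∀ (t u : Tid), t ≠ u → ∀ (A₁ A₂ : Pred2 Var Val) (σ σ' σ'' : Store Var Val),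
    (M A₁ t σ).1 ≤ Effect.N → (t, σ, σ') ∈ A₁ →
    (M A₂ u σ).1 ≤ Effect.L → (u, σ, σ'') ∈ A₂ →
    ∃ σ''' : Store Var Val, (u, σ', σ''') ∈ A₂ ∧ (t, σ'', σ''') ∈ A₁

/-! The logic -/

/-- `Two(S)`. -/
def two {Var Val : Type*} (S : Pred1 Var Val) : Pred2 Var Val :=
  {p | (p.1, p.2.1) ∈ S ∧ p.2.2 = p.2.1}

/-- `Post(P)`. -/
def post {Var Val : Type*} (P : Pred2 Var Val) : Pred1 Var Val :=
  {p | ∃ σ₀ : Store Var Val, (p.1, σ₀, p.2) ∈ P}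

/-- The identity action `I`. -/
def idAction {Var Val : Type*} : Pred2 Var Val :=
  {p | p.2.2 = p.2.1}

/-- `P ; A`. -/
def comp {Var Val : Type*} (P A : Pred2 Var Val) : Pred2 Var Val :=
  {p | ∃ σ' : Store Var Val, (p.1, p.2.1, σ') ∈ P ∧ (p.1, σ', p.2.2) ∈ A}

/-- `Yield(P, R)`. -/
def yieldPost {Var Val : Type*} (P R : Pred2 Var Val) : Pred2 Var Val :=
  {p | p.2.2 = p.2.1 ∧ ∃ σ₀ σ : Store Var Val, (p.1, σ₀, σ) ∈ P ∧
    Relation.ReflTransGen (fun a b => (p.1, a, b) ∈ R) σ p.2.1}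

/-- The judgment `R; G ⊢ s : P → Q · e`. -/
inductive Judgment {F Var Val : Type*} (M : MoverSpec Var Val) (D : DeclTable F Var Val) :
    Pred2 Var Val → Pred2 Var Val → Stmt F Var Val → Pred2 Var Val → Pred2 Var Val →
      Effect → Prop
  | action (R G : Pred2 Var Val) (A P : Pred2 Var Val)
      (hT : M.on A P ≤ Effect.L → Total A) :
      Judgment M D R G (.action A) P (comp P A) (M.on A P)
  | seq (R G : Pred2 Var Val) (s₁ s₂ : Stmt F Var Val) (P Q₁ Q₂ : Pred2 Var Val)
      (e₁ e₂ : Effect)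
      (h₁ : Judgment M D R G s₁ P Q₁ e₁) (h₂ : Judgment M D R G s₂ Q₁ Q₂ e₂) :
      Judgment M D R G (.seq s₁ s₂) P Q₂ (e₁.seq e₂)
  | ite (R G : Pred2 Var Val) (C : CondAction Var Val) (s₁ s₂ : Stmt F Var Val)
      (P Q : Pred2 Var Val) (e₁ e₂ : Effect)
      (h₁ : Judgment M D R G s₁ (comp P C.onTrue) Q e₁)
      (h₂ : Judgment M D R G s₂ (comp P C.onFalse) Q e₂) :
      Judgment M D R G (.ite C s₁ s₂) P Q
        (((M.on C.onTrue P).seq e₁) ⊔ ((M.on C.onFalse P).seq e₂))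
  | while (R G : Pred2 Var Val) (C : CondAction Var Val) (s : Stmt F Var Val)
      (P : Pred2 Var Val) (e₁ e : Effect)
      (h₁ : Judgment M D R G s (comp P C.onTrue) P e₁)
      (he : e = (((M.on C.onTrue P).seq e₁).star).seq (M.on C.onFalse P))
      (hL : ¬ e ≤ Effect.L) :
      Judgment M D R G (.while C s) P (comp P C.onFalse) e
  | skip (R G P : Pred2 Var Val) :
      Judgment M D R G .skip P P Effect.B
  | wrong (R G : Pred2 Var Val) :
      Judgment M D R G .wrong ∅ ∅ Effect.B
  | conseq (R R₁ G G₁ : Pred2 Var Val) (s : Stmt F Var Val) (P P₁ Q Q₁ : Pred2 Var Val)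
      (e e₁ : Effect)
      (hP : P ⊆ P₁) (hQ : Q₁ ⊆ Q) (hR : R ⊆ R₁) (hG : G₁ ⊆ G) (he : e₁ ≤ e)
      (h : Judgment M D R₁ G₁ s P₁ Q₁ e₁) :
      Judgment M D R G s P Q e
  | yield (R G P : Pred2 Var Val) (hG : P ⊆ G) :
      Judgment M D R G .yield P (yieldPost P R) Effect.Y
  | callAtomic (R G P : Pred2 Var Val) (fn : FnDecl F Var Val) (e : Effect)
      (S : Pred1 Var Val) (Q : Pred2 Var Val)
      (hD : fn ∈ D.fns) (hspec : fn.spec = .atomic e S Q) (hS : post P ⊆ S) :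
      Judgment M D R G (.call fn.name) P (comp P Q) e
  | callNonAtomic (R G : Pred2 Var Val) (fn : FnDecl F Var Val) (S T : Pred1 Var Val)
      (hD : fn ∈ D.fns) (hspec : fn.spec = .nonAtomic R G S T) :
      Judgment M D R G (.call fn.name) (two S) (two T) Effect.R

/-- The body of the declared function `f` contains a call of `g`. -/
def Calls {F Var Val : Type*} (D : DeclTable F Var Val) (f g : F) : Prop :=
  ∃ fn ∈ D.fns, fn.name = f ∧ g ∈ fn.body.callees

/-- `f` calls itself, directly or indirectly. -/
def IsRecursive {F Var Val : Type*} (D : DeclTable F Var Val) (f : F) : Prop :=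
  Relation.TransGen (Calls D) f f

/-- The judgment `⊢ fn`. -/
inductive FnJudgment {F Var Val : Type*} (M : MoverSpec Var Val) (D : DeclTable F Var Val) :
    FnDecl F Var Val → Prop
  | atomic (f : F) (s : Stmt F Var Val) (e : Effect) (S : Pred1 Var Val) (Q : Pred2 Var Val)
      (hrec : ¬ IsRecursive D f) (h : Judgment M D ∅ ∅ s (two S) Q e) :
      FnJudgment M D ⟨.atomic e S Q, f, s⟩
  | nonAtomic (f : F) (s : Stmt F Var Val) (R G : Pred2 Var Val) (S T : Pred1 Var Val)
      (h : Judgment M D R G s (two S) (two T) Effect.R) (hG : G ≠ ∅) :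
      FnJudgment M D ⟨.nonAtomic R G S T, f, s⟩

/-- The statement is about to execute `yield`. -/
def Stmt.IsYielding {F Var Val : Type*} (s : Stmt F Var Val) : Prop :=
  ∃ E : Ctx F Var Val, s = E.fill .yield

/-- The judgment `⊢ Σ`. -/
inductive StateJudgment {F Var Val : Type*} {n : ℕ} (M : MoverSpec Var Val)
    (D : DeclTable F Var Val) : State F Var Val n → Prop
  | state (X : State F Var Val n) (R G : Pred2 Var Val) (P Q : Fin n → Pred2 Var Val)
      (e : Fin n → Effect)
      (hfn : ∀ fn ∈ D.fns, FnJudgment M D fn)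
      (hM : M.Valid)
      (hI : idAction ⊆ G)
      (hthread : ∀ i : Fin n,
        Judgment M D R G (X.threads i) (P i) (Q i) (e i) ∧ e i ≠ Effect.E ∧ Q i ⊆ G ∧
          (X.threads i).IsYielding ∧ (tid i, X.store, X.store) ∈ P i)
      (hRG : ∀ i j : Fin n, i ≠ j → ∀ σ σ' : Store Var Val,
        (tid i, σ, σ') ∈ G → (tid j, σ, σ') ∈ R) :
      StateJudgment M D X

end MoverLogic

/-! The proof is Lipton reduction, by induction on the length of an execution that starts where
every thread has terminated or is at a yield. Between two such points a thread executes a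
transaction. Its effects drive a two-state automaton: in phase `R`, before the commit point, only
right movers have occurred since the last yield; in phase `N`, after it, only left movers may
follow. A step is legal when composing the phase with its effect does not give `E`.

Let such an execution go from `X` to `Y`. As long as no thread has committed, each thread could have
executed its part of the current transaction first, from `X`, with the others following by right
movers (`Uncommitted`). A further step of thread `i` moves left past those right movers
(`OtherExec.moveLeft`). If it ends the transaction, then the whole transaction of `i` has been moved
to the front. It satisfies the guarantee of `i`, hence the rely of the other threads, so the rest is
a shorter execution that again starts with all threads between transactions.

If the step commits thread `c`, the transaction of `c` stays at the front and the others follow by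
arbitrary steps with effect at most `N`; the later steps of `c` are left movers and join the front
(`stateSafe_of_exec_committed`). The transaction may still be unfinished when the execution stops.
Then `c` can finish it alone: code with effect at most `L` has no loop to execute before its next
yield, and its actions are total (`Typing.exists_idle`). The other threads do not block these left
movers (`OtherExec.push_run`), and the induction hypothesis applies with `c` finished. The steps of
`c` leave the statements of the others and the effects of their actions unchanged, so safety carries
back. -/

namespace MoverLogic

/-! ### Algebra of effects -/

namespace Effect

theorem seq_assoc (a b c : Effect) : (a.seq b).seq c = a.seq (b.seq c) := by
  cases a <;> cases b <;> cases c <;> rfl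

theorem seq_mono {a a' b b' : Effect} (ha : a ≤ a') (hb : b ≤ b') : a.seq b ≤ a'.seq b' := by
  revert a a' b b'; decide

theorem seq_both (a : Effect) : a.seq B = a := by
  cases a <;> rfl

theorem ne_yield_of_both_le {a : Effect} (h : B ≤ a) : a ≠ Y := by
  revert a; decide

theorem le_nonMover_of_ne_error {a : Effect} (h : a ≠ E) : a ≤ N := by
  revert a; decide

theorem le_leftMover_of_seq_le {a b : Effect} (h : a.seq b ≤ L) : a ≤ L := by
  revert a b; decide

/-- The exception is real: `Y; N = L`, since a non mover right after a yield is harmless. -/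
theorem le_leftMover_of_seq_le' {a b : Effect} (ha : a ≠ Y) (h : a.seq b ≤ L) : b ≤ L := by
  revert a b; decide

theorem seq_ne_yield {a b : Effect} (ha : a ≠ Y) (hb : b ≠ Y) (h : a.seq b ≤ L) :
    a.seq b ≠ Y := by
  revert a b; decide

/-- The effect of a loop absorbs one more iteration and also the immediate exit. Loops below `L`
must be excluded: an iteration that yields can lower the effect of the exit test, as in `Y; N = L`.
-/
theorem while_unfold {m₁ e₁ m₂ : Effect} (h : ¬ ((m₁.seq e₁).star).seq m₂ ≤ L) :
    m₁.seq (e₁.seq (((m₁.seq e₁).star).seq m₂)) ≤ ((m₁.seq e₁).star).seq m₂ ∧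
      m₂ ≤ ((m₁.seq e₁).star).seq m₂ := by
  revert m₁ e₁ m₂; decide

/-- The effects `R` and `N`, viewed as the phases of a transaction before and after its commit
point. -/
def IsPhase (p : Effect) : Prop := p = R ∨ p = N

theorem IsPhase.seq {p e : Effect} (hp : p.IsPhase) (h : p.seq e ≠ E) : (p.seq e).IsPhase := by
  unfold IsPhase at *
  revert p e; decide

theorem IsPhase.ne_error_of_seq {p e : Effect} (hp : p.IsPhase) (h : p.seq e ≠ E) : e ≠ E := by
  unfold IsPhase at *
  revert p e; decide

theorem right_seq_ne_error {e : Effect} (h : e ≠ E) : R.seq e ≠ E := by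
  revert e; decide

theorem nonMover_seq_ne_error {e : Effect} : N.seq e ≠ E ↔ e ≤ L := by
  revert e; decide

theorem right_seq_eq_right {e : Effect} : R.seq e = R ↔ e ≤ R := by
  revert e; decide

theorem nonMover_seq_eq {e : Effect} (hY : e ≠ Y) (h : e ≤ L) : N.seq e = N := by
  revert e; decide

theorem ne_error_of_seq_ne_error {a b : Effect} (h : a.seq b ≠ E) : a ≠ E := by
  revert a b; decide

theorem ne_error_of_le {a b : Effect} (hab : a ≤ b) (hb : b ≠ E) : a ≠ E := by
  revert a b; decide

end Effect

variable {F Var Val : Type*} {n : ℕ}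

/-! ### Labelled steps of one statement -/

/-- Labels of thread steps. -/
inductive Label (Var Val : Type*)
  | yld : Label Var Val
  | silent : Label Var Val
  | act (A : Pred2 Var Val) : Label Var Val

/-- The effect of a label, for a thread and the store in which it is executed. -/
def Label.eff (M : MoverSpec Var Val) (t : Tid) (σ : Store Var Val) : Label Var Val → Effect
  | .yld => Effect.Y
  | .silent => Effect.B
  | .act A => (M A t σ).1

/-- The effect of a label on the store. -/
def Label.rel (t : Tid) (σ σ' : Store Var Val) : Label Var Val → Prop
  | .yld => σ' = σ
  | .silent => σ' = σ
  | .act A => (t, σ, σ') ∈ A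

theorem Label.eff_ne_yield {M : MoverSpec Var Val} {t : Tid} {σ : Store Var Val}
    {a : Label Var Val} (h : a ≠ .yld) : a.eff M t σ ≠ Effect.Y := by
  cases a with
  | yld => exact absurd rfl h
  | silent => exact fun h => nomatch h
  | act A => exact (M A t σ).2

/-- The syntactic part of a thread step. -/
inductive SStep (D : DeclTable F Var Val) :
    Stmt F Var Val → Label Var Val → Stmt F Var Val → Prop
  | seqSkip (s : Stmt F Var Val) : SStep D (.seq .skip s) .silent s
  | seqStep {s₁ s₁' : Stmt F Var Val} {a : Label Var Val} (s₂ : Stmt F Var Val)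
      (h : SStep D s₁ a s₁') : SStep D (.seq s₁ s₂) a (.seq s₁' s₂)
  | yield : SStep D .yield .yld .skip
  | action (A : Pred2 Var Val) : SStep D (.action A) (.act A) .skip
  | iteTrue (C : CondAction Var Val) (s₁ s₂ : Stmt F Var Val) :
      SStep D (.ite C s₁ s₂) (.act C.onTrue) s₁
  | iteFalse (C : CondAction Var Val) (s₁ s₂ : Stmt F Var Val) :
      SStep D (.ite C s₁ s₂) (.act C.onFalse) s₂
  | loop (C : CondAction Var Val) (s : Stmt F Var Val) :
      SStep D (.while C s) .silent (.ite C (.seq s (.while C s)) .skip)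
  | call (fn : FnDecl F Var Val) (h : fn ∈ D.fns) : SStep D (.call fn.name) .silent fn.body

variable {D : DeclTable F Var Val} {M : MoverSpec Var Val}

theorem SStep.fill {s s' : Stmt F Var Val} {a : Label Var Val} (h : SStep D s a s')
    (E : Ctx F Var Val) : SStep D (E.fill s) a (E.fill s') := by
  induction E with
  | hole => exact h
  | seq E s₂ ih => exact .seqStep s₂ ih

theorem ThreadStep.exists_sstep {t : Tid} {s s' : Stmt F Var Val} {σ σ' : Store Var Val}
    (h : ThreadStep D t s σ s' σ') : ∃ a, SStep D s a s' ∧ a.rel t σ σ' := by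
  cases h with
  | seq E s => exact ⟨.silent, (SStep.seqSkip s).fill E, rfl⟩
  | yield E => exact ⟨.yld, SStep.yield.fill E, rfl⟩
  | action E A _ _ h => exact ⟨.act A, (SStep.action A).fill E, h⟩
  | iteTrue E C s₁ s₂ _ _ h => exact ⟨.act C.onTrue, (SStep.iteTrue C s₁ s₂).fill E, h⟩
  | iteFalse E C s₁ s₂ _ _ h => exact ⟨.act C.onFalse, (SStep.iteFalse C s₁ s₂).fill E, h⟩
  | call E fn _ h => exact ⟨.silent, (SStep.call fn h).fill E, rfl⟩
  | _ E C s =>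
    exact ⟨.silent, (SStep.loop C s).fill E, rfl⟩

theorem SStep.label_eq_yld {s s' s'' : Stmt F Var Val} {a b : Label Var Val}
    (h : SStep D s a s') (ha : a = .yld) (h' : SStep D s b s'') : b = .yld := by
  induction h generalizing s'' with
  | seqStep s₂ h ih =>
    cases h' with
    | seqSkip => cases h
    | seqStep _ h' => exact ih ha h'
  | yield => cases h'; rfl
  | _ => cases ha

/-- The statement has terminated or is about to yield. -/
def Stmt.Idle (D : DeclTable F Var Val) (s : Stmt F Var Val) : Prop :=
  s = .skip ∨ ∃ s', SStep D s .yld s'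

theorem Stmt.Idle.label_eq_yld {s s' : Stmt F Var Val} {a : Label Var Val} (hs : s.Idle D)
    (h : SStep D s a s') : a = .yld := by
  rcases hs with rfl | ⟨s'', hs⟩
  · cases h
  · exact hs.label_eq_yld rfl h

theorem Stmt.IsYielding.exists_sstep {s : Stmt F Var Val} (h : s.IsYielding)
    (D : DeclTable F Var Val) : ∃ s', SStep D s .yld s' := by
  obtain ⟨E, rfl⟩ := h
  exact ⟨_, SStep.yield.fill E⟩

/-! Commutation of labels of different threads -/

theorem MoverSpec.Valid.eff_stable (hM : M.Valid) {t u : Tid} (htu : t ≠ u)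
    {a : Label Var Val} (b : Label Var Val) {σ σ' : Store Var Val} (ha : a.eff M t σ ≤ Effect.N)
    (h : a.rel t σ σ') : b.eff M u σ' = b.eff M u σ := by
  cases a with
  | yld => cases h; rfl
  | silent => cases h; rfl
  | act A =>
    cases b with
    | yld => rfl
    | silent => rfl
    | act B => exact hM.stable t u htu A B σ σ' ha h _ rfl

/-- The second label can be executed before the first. -/
def Effect.Swappable (e₁ e₂ : Effect) : Prop :=
  e₁ ≤ Effect.R ∧ e₂ ≤ Effect.N ∨ e₁ ≤ Effect.N ∧ e₂ ≤ Effect.L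

theorem Effect.Swappable.left_le {e₁ e₂ : Effect} (h : e₁.Swappable e₂) : e₁ ≤ Effect.N := by
  unfold Effect.Swappable at h
  revert e₁ e₂; decide

theorem Effect.Swappable.right_le {e₁ e₂ : Effect} (h : e₁.Swappable e₂) : e₂ ≤ Effect.N := by
  unfold Effect.Swappable at h
  revert e₁ e₂; decide

theorem MoverSpec.Valid.swap (hM : M.Valid) {t u : Tid} (htu : t ≠ u) {a b : Label Var Val}
    {σ σ' σ'' : Store Var Val} (ha : a.rel t σ σ') (hb : b.rel u σ' σ'')
    (he : (a.eff M t σ).Swappable (b.eff M u σ')) :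
    ∃ σ''', b.rel u σ σ''' ∧ a.rel t σ''' σ'' := by
  cases a with
  | yld => cases ha; exact ⟨σ'', hb, rfl⟩
  | silent => cases ha; exact ⟨σ'', hb, rfl⟩
  | act A =>
    cases b with
    | yld => cases hb; exact ⟨σ, rfl, ha⟩
    | silent => cases hb; exact ⟨σ, rfl, ha⟩
    | act B =>
      rcases he with ⟨h₁, h₂⟩ | ⟨h₁, h₂⟩
      · exact hM.right t u htu A B σ σ' σ'' h₁ ha h₂ hb
      · exact hM.left t u htu A B σ σ' σ'' h₁ ha h₂ hb

theorem MoverSpec.Valid.diamond (hM : M.Valid) {t u : Tid} (htu : t ≠ u) {a b : Label Var Val}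
    {σ σ' σ'' : Store Var Val} (ha : a.rel t σ σ') (hb : b.rel u σ σ'')
    (hea : a.eff M t σ ≤ Effect.N) (heb : b.eff M u σ ≤ Effect.L) :
    ∃ σ''', b.rel u σ' σ''' ∧ a.rel t σ'' σ''' := by
  cases a with
  | yld => cases ha; exact ⟨σ'', hb, rfl⟩
  | silent => cases ha; exact ⟨σ'', hb, rfl⟩
  | act A =>
    cases b with
    | yld => cases hb; exact ⟨σ', rfl, ha⟩
    | silent => cases hb; exact ⟨σ', rfl, ha⟩
    | act B => exact hM.nonblocking t u htu A B σ σ' σ'' hea ha heb hb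

/-! A version of the judgment with slack in every rule, in which the bodies of atomic functions are
checked at the call -/

theorem comp_mono {P P' A : Pred2 Var Val} (h : P ⊆ P') : comp P A ⊆ comp P' A :=
  fun _ ⟨σ, h₁, h₂⟩ => ⟨σ, h h₁, h₂⟩

theorem comp_mono_right {P A A' : Pred2 Var Val} (h : A ⊆ A') : comp P A ⊆ comp P A' :=
  fun _ ⟨σ, h₁, h₂⟩ => ⟨σ, h₁, h h₂⟩

theorem comp_assoc (P Q A : Pred2 Var Val) : comp (comp P Q) A = comp P (comp Q A) := by
  ext p
  constructor
  · rintro ⟨σ, ⟨τ, h₁, h₂⟩, h₃⟩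
    exact ⟨τ, h₁, σ, h₂, h₃⟩
  · rintro ⟨τ, h₁, σ, h₂, h₃⟩
    exact ⟨σ, ⟨τ, h₁, h₂⟩, h₃⟩

theorem yieldPost_mono {P P' R R' : Pred2 Var Val} (hP : P ⊆ P') (hR : R ⊆ R') :
    yieldPost P R ⊆ yieldPost P' R' :=
  fun _ ⟨h, σ₀, σ, h₁, h₂⟩ => ⟨h, σ₀, σ, hP h₁, Relation.ReflTransGen.mono (fun _ _ h => hR h) _ _ h₂⟩

/-- The action `A` has effect at most `m` in all stores that `P` reaches. -/
def MoverSpec.Bounded (M : MoverSpec Var Val) (A P : Pred2 Var Val) (m : Effect) : Prop :=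
  ∀ t σ₀ σ, (t, σ₀, σ) ∈ P → (M A t σ).1 ≤ m

theorem MoverSpec.bounded_on (M : MoverSpec Var Val) (A P : Pred2 Var Val) :
    M.Bounded A P (M.on A P) :=
  fun t σ₀ σ h => le_sSup (α := Effect) ⟨t, σ₀, σ, h, rfl⟩

theorem MoverSpec.Bounded.mono {A P P' : Pred2 Var Val} {m m' : Effect} (h : M.Bounded A P m)
    (hP : P' ⊆ P) (hm : m ≤ m') : M.Bounded A P' m' :=
  fun t σ₀ σ h' => (h t σ₀ σ (hP h')).trans hm

theorem MoverSpec.Bounded.comp {A P : Pred2 Var Val} {m : Effect} (h : M.Bounded A P m)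
    (P₀ : Pred2 Var Val) : M.Bounded A (comp P₀ P) m :=
  fun t _ σ ⟨σ₁, _, h'⟩ => h t σ₁ σ h'

/-- `Judgment` with slack in every rule; atomic functions are typed by their bodies. -/
inductive Typing (M : MoverSpec Var Val) (D : DeclTable F Var Val) (R G : Pred2 Var Val) :
    Stmt F Var Val → Pred2 Var Val → Pred2 Var Val → Effect → Prop
  | action (A P Q : Pred2 Var Val) (e : Effect) (hM : M.Bounded A P e)
      (hT : e ≤ Effect.L → Total A) (hQ : comp P A ⊆ Q) : Typing M D R G (.action A) P Q e
  | seq (s₁ s₂ : Stmt F Var Val) (P Q₁ Q : Pred2 Var Val) (e₁ e₂ e : Effect)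
      (h₁ : Typing M D R G s₁ P Q₁ e₁) (h₂ : Typing M D R G s₂ Q₁ Q e₂)
      (he : e₁.seq e₂ ≤ e) : Typing M D R G (.seq s₁ s₂) P Q e
  | ite (C : CondAction Var Val) (s₁ s₂ : Stmt F Var Val) (P Q : Pred2 Var Val)
      (m₁ m₂ e₁ e₂ e : Effect) (hM₁ : M.Bounded C.onTrue P m₁) (hM₂ : M.Bounded C.onFalse P m₂)
      (h₁ : Typing M D R G s₁ (comp P C.onTrue) Q e₁)
      (h₂ : Typing M D R G s₂ (comp P C.onFalse) Q e₂)
      (he₁ : m₁.seq e₁ ≤ e) (he₂ : m₂.seq e₂ ≤ e) : Typing M D R G (.ite C s₁ s₂) P Q e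
  | loop (C : CondAction Var Val) (s : Stmt F Var Val) (P I Q : Pred2 Var Val)
      (m₁ m₂ e₁ e₀ e : Effect) (hM₁ : M.Bounded C.onTrue I m₁)
      (hM₂ : M.Bounded C.onFalse I m₂) (h : Typing M D R G s (comp I C.onTrue) I e₁)
      (hP : P ⊆ I) (hQ : comp I C.onFalse ⊆ Q) (he₁ : m₁.seq (e₁.seq e₀) ≤ e₀) (he₂ : m₂ ≤ e₀)
      (hL : ¬ e₀ ≤ Effect.L) (he : e₀ ≤ e) : Typing M D R G (.while C s) P Q e
  | skip (P Q : Pred2 Var Val) (e : Effect) (hQ : P ⊆ Q) (he : Effect.B ≤ e) :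
      Typing M D R G .skip P Q e
  | wrong (P Q : Pred2 Var Val) (e : Effect) (hP : P ⊆ ∅) : Typing M D R G .wrong P Q e
  | yield (P Q : Pred2 Var Val) (e : Effect) (hG : P ⊆ G) (hQ : yieldPost P R ⊆ Q) :
      Typing M D R G .yield P Q e
  | inline (fn : FnDecl F Var Val) (P Q : Pred2 Var Val) (e : Effect) (hD : fn ∈ D.fns)
      (h : Typing M D R G fn.body P Q e) : Typing M D R G (.call fn.name) P Q e
  | call (fn : FnDecl F Var Val) (R₁ G₁ : Pred2 Var Val) (S T : Pred1 Var Val)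
      (P Q : Pred2 Var Val) (e : Effect) (hD : fn ∈ D.fns)
      (hspec : fn.spec = .nonAtomic R₁ G₁ S T) (hne : G₁ ≠ ∅) (hP : P ⊆ two S)
      (hQ : two T ⊆ Q) (hR : R ⊆ R₁) (hG : G₁ ⊆ G) (he : Effect.R ≤ e) :
      Typing M D R G (.call fn.name) P Q e

theorem Typing.weaken {R R' G G' P P' Q Q' : Pred2 Var Val} {s : Stmt F Var Val} {e e' : Effect}
    (h : Typing M D R G s P Q e) (hR : R' ⊆ R) (hG : G ⊆ G') (hP : P' ⊆ P) (hQ : Q ⊆ Q')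
    (he : e ≤ e') : Typing M D R' G' s P' Q' e' := by
  induction h generalizing P' Q' e' with
  | action A P Q e hM hT hQ₁ =>
    exact .action _ _ _ _ (hM.mono hP he) (fun h => hT (he.trans h))
      ((comp_mono hP).trans (hQ₁.trans hQ))
  | seq s₁ s₂ P Q₁ Q e₁ e₂ e _ _ he₁ ih₁ ih₂ =>
    exact .seq _ _ _ Q₁ _ e₁ e₂ _ (ih₁ hP subset_rfl le_rfl) (ih₂ subset_rfl hQ le_rfl)
      (he₁.trans he)
  | ite C s₁ s₂ P Q m₁ m₂ e₁ e₂ e hM₁ hM₂ _ _ he₁ he₂ ih₁ ih₂ =>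
    exact .ite _ _ _ _ _ m₁ m₂ e₁ e₂ _ (hM₁.mono hP le_rfl) (hM₂.mono hP le_rfl)
      (ih₁ (comp_mono hP) hQ le_rfl) (ih₂ (comp_mono hP) hQ le_rfl) (he₁.trans he) (he₂.trans he)
  | loop C s P I Q m₁ m₂ e₁ e₀ e hM₁ hM₂ _ hP₁ hQ₁ he₁ he₂ hL he₀ ih =>
    exact .loop _ _ _ I _ m₁ m₂ e₁ e₀ _ hM₁ hM₂ (ih subset_rfl subset_rfl le_rfl)
      (hP.trans hP₁) (hQ₁.trans hQ) he₁ he₂ hL (he₀.trans he)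
  | skip P Q e hQ₁ he₁ => exact .skip _ _ _ (hP.trans (hQ₁.trans hQ)) (he₁.trans he)
  | wrong P Q e hP₁ => exact .wrong _ _ _ (hP.trans hP₁)
  | yield P Q e hG₁ hQ₁ =>
    exact .yield _ _ _ (hP.trans (hG₁.trans hG)) ((yieldPost_mono hP hR).trans (hQ₁.trans hQ))
  | inline fn P Q e hD _ ih => exact .inline _ _ _ _ hD (ih hP hQ he)
  | call fn R₁ G₁ S T P Q e hD hspec hne hP₁ hQ₁ hR₁ hG₁ he₁ =>
    exact .call fn R₁ G₁ S T _ _ _ hD hspec hne (hP.trans hP₁) (hQ₁.trans hQ) (hR.trans hR₁)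
      (hG₁.trans hG) (he₁.trans he)

/-- An empty guarantee makes the precondition of every yield empty and excludes calls of functions
with a nonempty guarantee. So nothing resets the start of the transaction, and an arbitrary prefix
`P₀` can be put in front; this is what allows an atomic body to be inlined after any caller. -/
theorem Typing.frame {R P Q : Pred2 Var Val} {s : Stmt F Var Val} {e : Effect}
    (h : Typing M D R ∅ s P Q e) (R' G' P₀ : Pred2 Var Val) :
    Typing M D R' G' s (comp P₀ P) (comp P₀ Q) e := by
  induction h with
  | action A P Q e hM hT hQ =>
    refine .action _ _ _ _ (hM.comp P₀) hT ?_
    rw [comp_assoc]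
    exact comp_mono_right hQ
  | seq s₁ s₂ P Q₁ Q e₁ e₂ e _ _ he ih₁ ih₂ => exact .seq _ _ _ _ _ e₁ e₂ _ ih₁ ih₂ he
  | ite C s₁ s₂ P Q m₁ m₂ e₁ e₂ e hM₁ hM₂ _ _ he₁ he₂ ih₁ ih₂ =>
    rw [← comp_assoc] at ih₁ ih₂
    exact .ite _ _ _ _ _ m₁ m₂ e₁ e₂ _ (hM₁.comp P₀) (hM₂.comp P₀) ih₁ ih₂ he₁ he₂
  | loop C s P I Q m₁ m₂ e₁ e₀ e hM₁ hM₂ _ hP hQ he₁ he₂ hL he ih =>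
    rw [← comp_assoc] at ih
    refine .loop _ _ _ (comp P₀ I) _ m₁ m₂ e₁ e₀ _ (hM₁.comp P₀) (hM₂.comp P₀) ih
      (comp_mono_right hP) ?_ he₁ he₂ hL he
    rw [comp_assoc]
    exact comp_mono_right hQ
  | skip P Q e hQ he => exact .skip _ _ _ (comp_mono_right hQ) he
  | wrong P Q e hP => exact .wrong _ _ _ fun _ ⟨_, _, h⟩ => (hP h).elim
  | yield P Q e hG hQ =>
    exact .yield _ _ _ (fun _ ⟨_, _, h⟩ => (hG h).elim)
      fun _ ⟨_, _, _, ⟨_, _, h⟩, _⟩ => (hG h).elim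
  | inline fn P Q e hD _ ih => exact .inline _ _ _ _ hD ih
  | call fn R₁ G₁ S T P Q e hD hspec hne hP hQ hR hG he =>
    exact absurd (Set.subset_empty_iff.mp hG) hne

theorem DeclTable.eq_of_name_eq (D : DeclTable F Var Val) {f g : FnDecl F Var Val}
    (hf : f ∈ D.fns) (hg : g ∈ D.fns) (h : f.name = g.name) : f = g :=
  List.inj_on_of_nodup_map D.nodup hf hg h

/-! ### Subject reduction -/

/-- All functions that are not atomic have well typed bodies. -/
def BodiesTyped (M : MoverSpec Var Val) (D : DeclTable F Var Val) : Prop :=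
  ∀ fn ∈ D.fns, ∀ R G S T, fn.spec = .nonAtomic R G S T →
    Typing M D R G fn.body (two S) (two T) Effect.R

/-- The stores at the start and at the end of the current transaction after a step of thread `t`,
where other threads run at yields. -/
def Label.Advance (R : Pred2 Var Val) (t : Tid) (σ₀ σ σ₀' σ' : Store Var Val) :
    Label Var Val → Prop
  | .yld => σ₀' = σ' ∧ Relation.ReflTransGen (fun a b => (t, a, b) ∈ R) σ σ'
  | .silent => σ₀' = σ₀ ∧ σ' = σ
  | .act A => σ₀' = σ₀ ∧ (t, σ, σ') ∈ A

theorem Label.advance_of_rel {R : Pred2 Var Val} {t : Tid} {σ₀ σ σ' : Store Var Val}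
    {a : Label Var Val} (ha : a ≠ .yld) (h : a.rel t σ σ') : a.Advance R t σ₀ σ σ₀ σ' := by
  cases a with
  | yld => exact absurd rfl ha
  | silent => exact ⟨rfl, h⟩
  | act A => exact ⟨rfl, h⟩

/-- The new precondition and effect are chosen before the new store, and the step need not be
enabled in `σ`. The bound on the effect therefore holds for blocked steps too. -/
theorem Typing.preservation (hB : BodiesTyped M D) {R G P Q : Pred2 Var Val}
    {s s' : Stmt F Var Val} {e : Effect} {a : Label Var Val} (h : Typing M D R G s P Q e)
    (hs : SStep D s a s') {t : Tid} {σ₀ σ : Store Var Val} (hP : (t, σ₀, σ) ∈ P) :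
    ∃ P' e', Typing M D R G s' P' Q e' ∧ (a.eff M t σ).seq e' ≤ e ∧
      ∀ σ₀' σ', a.Advance R t σ₀ σ σ₀' σ' → (t, σ₀', σ') ∈ P' := by
  induction h generalizing s' a with
  | action A P Q e hM hT hQ =>
    cases hs
    refine ⟨Q, .B, .skip _ _ _ subset_rfl le_rfl, ?_, ?_⟩
    · rw [Effect.seq_both]
      exact hM _ _ _ hP
    · rintro _ σ' ⟨rfl, h⟩
      exact hQ ⟨σ, hP, h⟩
  | seq s₁ s₂ P Q₁ Q e₁ e₂ e h₁ h₂ he ih₁ ih₂ =>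
    cases hs with
    | seqSkip =>
      cases h₁ with
      | skip _ _ _ hQ he₁ =>
        refine ⟨Q₁, e₂, h₂, (Effect.seq_mono he₁ le_rfl).trans he, ?_⟩
        rintro _ _ ⟨rfl, rfl⟩
        exact hQ hP
    | seqStep _ hs =>
      obtain ⟨P', e', h', he', hadv⟩ := ih₁ hs hP
      refine ⟨P', e'.seq e₂, .seq _ _ _ Q₁ _ e' e₂ _ h' h₂ le_rfl, ?_, hadv⟩
      rw [← Effect.seq_assoc]
      exact (Effect.seq_mono he' le_rfl).trans he
  | ite C s₁ s₂ P Q m₁ m₂ e₁ e₂ e hM₁ hM₂ h₁ h₂ he₁ he₂ ih₁ ih₂ =>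
    cases hs with
    | iteTrue =>
      refine ⟨_, e₁, h₁, (Effect.seq_mono (hM₁ _ _ _ hP) le_rfl).trans he₁, ?_⟩
      rintro _ σ' ⟨rfl, h⟩
      exact ⟨σ, hP, h⟩
    | iteFalse =>
      refine ⟨_, e₂, h₂, (Effect.seq_mono (hM₂ _ _ _ hP) le_rfl).trans he₂, ?_⟩
      rintro _ σ' ⟨rfl, h⟩
      exact ⟨σ, hP, h⟩
  | loop C s P I Q m₁ m₂ e₁ e₀ e hM₁ hM₂ h hPI hQ he₁ he₂ hL he ih =>
    cases hs
    -- The unfolded loop keeps the effect because `e₀` absorbs one iteration and the exit test.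
    refine ⟨P, e, .ite _ _ _ _ _ m₁ m₂ (e₁.seq e₀) .B _ (hM₁.mono hPI le_rfl)
      (hM₂.mono hPI le_rfl)
      (.seq _ _ _ I _ e₁ e₀ _
        (h.weaken subset_rfl subset_rfl (comp_mono hPI) subset_rfl le_rfl)
        (.loop _ _ _ I _ m₁ m₂ e₁ e₀ _ hM₁ hM₂ h subset_rfl hQ he₁ he₂ hL le_rfl) le_rfl)
      (.skip _ _ _ ((comp_mono hPI).trans hQ) le_rfl) (he₁.trans he) ?_, le_rfl, ?_⟩
    · rw [Effect.seq_both]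
      exact he₂.trans he
    · rintro _ _ ⟨rfl, rfl⟩
      exact hP
  | skip => cases hs
  | wrong => cases hs
  | yield P Q e hG hQ =>
    cases hs
    refine ⟨Q, .B, .skip _ _ _ subset_rfl le_rfl, bot_le (α := Effect), ?_⟩
    rintro _ σ' ⟨rfl, h⟩
    exact hQ ⟨rfl, σ₀, σ, hP, h⟩
  | inline fn P Q e hD h ih =>
    generalize hf : Stmt.call fn.name = s at hs
    cases hs with
    | call fn' hD' =>
      cases D.eq_of_name_eq hD hD' (Stmt.call.inj hf)
      refine ⟨P, e, h, le_rfl, ?_⟩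
      rintro _ _ ⟨rfl, rfl⟩
      exact hP
    | _ => cases hf
  | call fn R₁ G₁ S T P Q e hD hspec hne hPS hQ hR hG he =>
    generalize hf : Stmt.call fn.name = s at hs
    cases hs with
    | call fn' hD' =>
      cases D.eq_of_name_eq hD hD' (Stmt.call.inj hf)
      refine ⟨P, e, (hB fn hD R₁ G₁ S T hspec).weaken hR hG hPS hQ he, le_rfl, ?_⟩
      rintro _ _ ⟨rfl, rfl⟩
      exact hP
    | _ => cases hf

theorem not_sstep_call_yld (f : F) (s' : Stmt F Var Val) :
    ¬ SStep D (.call f) .yld s' := by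
  generalize hs : Stmt.call f = s
  intro h
  cases h <;> cases hs

theorem Typing.mem_guarantee {R G P Q : Pred2 Var Val}
    {s s' : Stmt F Var Val} {e : Effect} {a : Label Var Val} (h : Typing M D R G s P Q e)
    (hs : SStep D s a s') (ha : a = .yld) : P ⊆ G := by
  induction h generalizing s' with
  | seq s₁ s₂ P Q₁ Q e₁ e₂ e h₁ h₂ he ih₁ ih₂ =>
    cases hs with
    | seqSkip => cases ha
    | seqStep _ hs => exact ih₁ hs
  | yield P Q e hG hQ => exact hG
  | inline fn => exact absurd (ha ▸ hs) (not_sstep_call_yld fn.name s')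
  | call fn => exact absurd (ha ▸ hs) (not_sstep_call_yld fn.name s')
  | _ => cases hs <;> cases ha

theorem Typing.not_wrong {R G P Q : Pred2 Var Val} {E : Ctx F Var Val} {e : Effect}
    (h : Typing M D R G (E.fill .wrong) P Q e) : P ⊆ ∅ := by
  induction E generalizing Q e with
  | hole => cases h with | wrong _ _ _ h => exact h
  | seq E s₂ ih => cases h with | seq _ _ _ _ _ _ _ _ h₁ => exact ih h₁

/-! ### Termination of runs of left movers -/

/-- One step of thread `t` by itself that does not yield and is a left mover. -/
def LeftStep (M : MoverSpec Var Val) (D : DeclTable F Var Val) (t : Tid)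
    (c c' : Stmt F Var Val × Store Var Val) : Prop :=
  ∃ a, SStep D c.1 a c'.1 ∧ a ≠ .yld ∧ a.rel t c.2 c'.2 ∧ a.eff M t c.2 ≤ Effect.L

theorem LeftStep.run_head {t : Tid} {s s' : Stmt F Var Val} {σ σ' : Store Var Val}
    {c : Stmt F Var Val × Store Var Val} (a : Label Var Val) (hs : SStep D s a s')
    (ha : a ≠ .yld) (hr : a.rel t σ σ') (he : a.eff M t σ ≤ Effect.L)
    (h : Relation.ReflTransGen (LeftStep M D t) (s', σ') c) :
    Relation.ReflTransGen (LeftStep M D t) (s, σ) c :=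
  .head ⟨a, hs, ha, hr, he⟩ h

theorem LeftStep.run_seq {t : Tid} {s s' : Stmt F Var Val} {σ σ' : Store Var Val}
    (h : Relation.ReflTransGen (LeftStep M D t) (s, σ) (s', σ')) (s₂ : Stmt F Var Val) :
    Relation.ReflTransGen (LeftStep M D t) (.seq s s₂, σ) (.seq s' s₂, σ') := by
  generalize hc : (s, σ) = c at h
  induction h using Relation.ReflTransGen.head_induction_on generalizing s σ with
  | refl => cases hc; exact .refl
  | head h _ ih =>
    subst hc
    obtain ⟨a, hs, ha, hr, he⟩ := h
    exact run_head a (.seqStep s₂ hs) ha hr he (ih rfl)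

/-- Structural induction suffices: loops and calls of non-atomic functions never have effect at most
`L`, and the actions that remain are enabled. The conjunct `e ≠ Effect.Y` serves sequencing: a first
part that ends without yielding does not have effect `Y`, so the bound `L` on the composition passes
to the second part. -/
theorem Typing.exists_idle {R G P Q : Pred2 Var Val} {s : Stmt F Var Val} {e : Effect}
    (h : Typing M D R G s P Q e) (he : e ≤ Effect.L) {t : Tid} {σ₀ σ : Store Var Val}
    (hP : (t, σ₀, σ) ∈ P) :
    ∃ s' σ', Relation.ReflTransGen (LeftStep M D t) (s, σ) (s', σ') ∧
      ((∃ s'', SStep D s' .yld s'') ∨ s' = .skip ∧ (t, σ₀, σ') ∈ Q ∧ e ≠ Effect.Y) := by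
  induction h generalizing σ with
  | action A P Q e hM hT hQ =>
    obtain ⟨σ', hσ'⟩ := hT he t σ
    refine ⟨.skip, σ', .single ⟨.act A, .action A, nofun, hσ', (hM _ _ _ hP).trans he⟩,
      .inr ⟨rfl, hQ ⟨σ, hP, hσ'⟩, ?_⟩⟩
    rintro rfl
    exact (M A t σ).2 (le_bot_iff (α := Effect).mp (hM _ _ _ hP))
  | seq s₁ s₂ P Q₁ Q e₁ e₂ e h₁ h₂ hle ih₁ ih₂ =>
    have hL := hle.trans he
    obtain ⟨s', σ', hrun, ⟨s'', hy⟩ | ⟨rfl, hQ, hY⟩⟩ := ih₁ (Effect.le_leftMover_of_seq_le hL) hP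
    · exact ⟨_, σ', LeftStep.run_seq hrun s₂, .inl ⟨_, .seqStep s₂ hy⟩⟩
    · obtain ⟨s'', σ'', hrun', hend⟩ := ih₂ (Effect.le_leftMover_of_seq_le' hY hL) hQ
      refine ⟨s'', σ'', (LeftStep.run_seq hrun s₂).trans
        (LeftStep.run_head .silent (.seqSkip s₂) nofun rfl (by decide : Effect.B ≤ Effect.L) hrun'),
        hend.imp_right fun ⟨h₁, h₂, h₃⟩ => ⟨h₁, h₂, ?_⟩⟩
      rintro rfl
      exact Effect.seq_ne_yield hY h₃ hL (le_bot_iff (α := Effect).mp hle)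
  | ite C s₁ s₂ P Q m₁ m₂ e₁ e₂ e hM₁ hM₂ h₁ h₂ he₁ he₂ ih₁ ih₂ =>
    obtain ⟨σ', hσ' | hσ'⟩ := C.total t σ
    · have hm := hM₁ _ _ _ hP
      have hle : ((M C.onTrue t σ).1).seq e₁ ≤ e := (Effect.seq_mono hm le_rfl).trans he₁
      have hL := hle.trans he
      obtain ⟨s', σ'', hrun, hend⟩ := ih₁
        (Effect.le_leftMover_of_seq_le' (M C.onTrue t σ).2 hL) ⟨σ, hP, hσ'⟩
      refine ⟨s', σ'', LeftStep.run_head (.act C.onTrue) (.iteTrue C s₁ s₂) nofun hσ'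
        (Effect.le_leftMover_of_seq_le hL) hrun, hend.imp_right fun ⟨h₁, h₂, h₃⟩ => ⟨h₁, h₂, ?_⟩⟩
      rintro rfl
      exact Effect.seq_ne_yield (M C.onTrue t σ).2 h₃ hL (le_bot_iff (α := Effect).mp hle)
    · have hm := hM₂ _ _ _ hP
      have hle : ((M C.onFalse t σ).1).seq e₂ ≤ e := (Effect.seq_mono hm le_rfl).trans he₂
      have hL := hle.trans he
      obtain ⟨s', σ'', hrun, hend⟩ := ih₂
        (Effect.le_leftMover_of_seq_le' (M C.onFalse t σ).2 hL) ⟨σ, hP, hσ'⟩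
      refine ⟨s', σ'', LeftStep.run_head (.act C.onFalse) (.iteFalse C s₁ s₂) nofun hσ'
        (Effect.le_leftMover_of_seq_le hL) hrun, hend.imp_right fun ⟨h₁, h₂, h₃⟩ => ⟨h₁, h₂, ?_⟩⟩
      rintro rfl
      exact Effect.seq_ne_yield (M C.onFalse t σ).2 h₃ hL (le_bot_iff (α := Effect).mp hle)
  | loop C s P I Q m₁ m₂ e₁ e₀ e hM₁ hM₂ h hPI hQ he₁ he₂ hL hle ih =>
    exact absurd (hle.trans he) hL
  | skip P Q e hQ hB =>
    exact ⟨.skip, σ, .refl, .inr ⟨rfl, hQ hP, Effect.ne_yield_of_both_le hB⟩⟩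
  | wrong P Q e hP₁ => exact (hP₁ hP).elim
  | yield P Q e hG hQ => exact ⟨.yield, σ, .refl, .inl ⟨_, .yield⟩⟩
  | inline fn P Q e hD h ih =>
    obtain ⟨s', σ', hrun, hend⟩ := ih he hP
    exact ⟨s', σ', LeftStep.run_head .silent (.call fn hD) nofun rfl (by decide : Effect.B ≤ Effect.L) hrun, hend⟩
  | call fn R₁ G₁ S T P Q e hD hspec hne hPS hQ hR hG hle =>
    exact absurd (hle.trans he) (by decide)

/-! ### Inlining the atomic functions -/

theorem comp_two_of_post_subset {P : Pred2 Var Val} {S : Pred1 Var Val} (h : post P ⊆ S) :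
    P ⊆ comp P (two S) :=
  fun p hp => ⟨p.2.2, hp, h ⟨p.2.1, hp⟩, rfl⟩

/-- Atomic bodies are assumed typed only for the callees of `s`, so that the lemma can be used
inside an induction along the call graph. -/
theorem Judgment.typing {R G P Q : Pred2 Var Val} {s : Stmt F Var Val} {e : Effect}
    (h : Judgment M D R G s P Q e)
    (hat : ∀ fn ∈ D.fns, ∀ e S Q, fn.spec = .atomic e S Q → fn.name ∈ s.callees →
      Typing M D ∅ ∅ fn.body (two S) Q e)
    (hna : ∀ fn ∈ D.fns, ∀ R G S T, fn.spec = .nonAtomic R G S T → G ≠ ∅) :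
    Typing M D R G s P Q e := by
  induction h with
  | action R G A P hT => exact .action _ _ _ _ (M.bounded_on A P) hT subset_rfl
  | seq R G s₁ s₂ P Q₁ Q₂ e₁ e₂ _ _ ih₁ ih₂ =>
    exact .seq _ _ _ Q₁ _ e₁ e₂ _
      (ih₁ fun fn hD e S Q hspec h => hat fn hD e S Q hspec (.inl h))
      (ih₂ fun fn hD e S Q hspec h => hat fn hD e S Q hspec (.inr h)) le_rfl
  | ite R G C s₁ s₂ P Q e₁ e₂ _ _ ih₁ ih₂ =>
    exact .ite _ _ _ _ _ _ _ e₁ e₂ _ (M.bounded_on _ P) (M.bounded_on _ P)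
      (ih₁ fun fn hD e S Q hspec h => hat fn hD e S Q hspec (.inl h))
      (ih₂ fun fn hD e S Q hspec h => hat fn hD e S Q hspec (.inr h)) le_sup_left le_sup_right
  | skip R G P => exact .skip _ _ _ subset_rfl le_rfl
  | wrong R G => exact .wrong _ _ _ subset_rfl
  | conseq R R₁ G G₁ s P P₁ Q Q₁ e e₁ hP hQ hR hG he _ ih =>
    exact (ih hat).weaken hR hG hP hQ he
  | yield R G P hG => exact .yield _ _ _ hG subset_rfl
  | callAtomic R G P fn e S Q hD hspec hS =>
    exact .inline _ _ _ _ hD (((hat fn hD e S Q hspec rfl).frame R G P).weaken subset_rfl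
      subset_rfl (comp_two_of_post_subset hS) subset_rfl le_rfl)
  | callNonAtomic R G fn S T hD hspec =>
    exact .call fn R G S T _ _ _ hD hspec (hna fn hD R G S T hspec) subset_rfl subset_rfl
      subset_rfl subset_rfl le_rfl
  | _ R G C s P e₁ e _ he hL ih =>
    subst he
    obtain ⟨h₁, h₂⟩ := Effect.while_unfold hL
    exact .loop _ _ _ P _ _ _ e₁ _ _ (M.bounded_on _ P) (M.bounded_on _ P) (ih hat) subset_rfl
      subset_rfl h₁ h₂ hL le_rfl

/-- The declared functions that `f` calls, directly or indirectly. -/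
def reachable (D : DeclTable F Var Val) (f : F) : Set (FnDecl F Var Val) :=
  {fn | fn ∈ D.fns ∧ Relation.TransGen (Calls D) f fn.name}

theorem finite_reachable (D : DeclTable F Var Val) (f : F) : (reachable D f).Finite :=
  (List.finite_toSet D.fns).subset fun _ h => h.1

/-- Induction on the number of declared functions reachable from `fn` by calls. -/
theorem typing_body_of_atomic (hfn : ∀ fn ∈ D.fns, FnJudgment M D fn) (fn : FnDecl F Var Val)
    (hD : fn ∈ D.fns) (e : Effect) (S : Pred1 Var Val) (Q : Pred2 Var Val)
    (hspec : fn.spec = .atomic e S Q) : Typing M D ∅ ∅ fn.body (two S) Q e := by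
  induction hk : (reachable D fn.name).ncard using Nat.strong_induction_on
    generalizing fn e S Q with
  | _ k ih =>
    cases hfn fn hD with
    | nonAtomic => cases hspec
    | atomic f s e S Q hrec h =>
      cases hspec
      refine h.typing (fun g hg e' S' Q' hspec' hcall => ?_) fun g hg R G S T hspec' => ?_
      · have hfg : Calls D f g.name := ⟨_, hD, rfl, hcall⟩
        refine ih _ ?_ g hg e' S' Q' hspec' rfl
        rw [← hk]
        -- The inclusion is strict because of `g`: it is reachable from `f` but, not being
        -- recursive, not from itself.
        refine Set.ncard_lt_ncard ⟨fun x hx => ⟨hx.1, .head hfg hx.2⟩, fun hsub => ?_⟩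
          (finite_reachable D f)
        have hgg : IsRecursive D g.name := (hsub ⟨hg, .single hfg⟩).2
        cases hfn g hg with
        | nonAtomic => cases hspec'
        | atomic _ _ _ _ _ hrec' => exact hrec' hgg
      · cases hfn g hg with
        | atomic => cases hspec'
        | nonAtomic _ _ _ _ _ _ _ hG => cases hspec'; exact hG

theorem Judgment.typing_of_fnJudgment (hfn : ∀ fn ∈ D.fns, FnJudgment M D fn)
    {R G P Q : Pred2 Var Val} {s : Stmt F Var Val} {e : Effect}
    (h : Judgment M D R G s P Q e) : Typing M D R G s P Q e := by
  refine h.typing (fun g hg e S Q hspec _ => typing_body_of_atomic hfn g hg e S Q hspec)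
    fun g hg R G S T hspec => ?_
  cases hfn g hg with
  | atomic => cases hspec
  | nonAtomic _ _ _ _ _ _ _ hG => cases hspec; exact hG

theorem bodiesTyped_of_fnJudgment (hfn : ∀ fn ∈ D.fns, FnJudgment M D fn) :
    BodiesTyped M D := by
  intro g hg R G S T hspec
  cases hfn g hg with
  | atomic => cases hspec
  | nonAtomic _ _ _ _ _ _ h => cases hspec; exact h.typing_of_fnJudgment hfn

/-! Threads in a transaction -/

/-- Between transactions: thread `t` has terminated or may resume from its yield. -/
def Resumable (M : MoverSpec Var Val) (D : DeclTable F Var Val) (R G : Pred2 Var Val) (t : Tid)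
    (s : Stmt F Var Val) (σ : Store Var Val) : Prop :=
  s = .skip ∨ (∃ s', SStep D s .yld s') ∧ ∃ P Q e σ₀ σ₁, Typing M D R G s P Q e ∧ Q ⊆ G ∧
    e ≠ Effect.E ∧ (t, σ₀, σ₁) ∈ P ∧ Relation.ReflTransGen (fun a b => (t, a, b) ∈ R) σ₁ σ

/-- In phase `p` of a transaction that thread `t` started in the store `σ₀`. -/
def Running (M : MoverSpec Var Val) (D : DeclTable F Var Val) (R G : Pred2 Var Val) (t : Tid)
    (p : Effect) (σ₀ : Store Var Val) (s : Stmt F Var Val) (σ : Store Var Val) : Prop :=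
  ∃ P Q e, Typing M D R G s P Q e ∧ Q ⊆ G ∧ p.seq e ≠ Effect.E ∧ (t, σ₀, σ) ∈ P

/-- In the middle of a transaction, or about to start one. -/
def Active (M : MoverSpec Var Val) (D : DeclTable F Var Val) (R G : Pred2 Var Val) (t : Tid)
    (p : Effect) (σ₀ : Store Var Val) (s : Stmt F Var Val) (σ : Store Var Val) : Prop :=
  (Running M D R G t p σ₀ s σ ∧ ¬ s.Idle D) ∨
    p = Effect.R ∧ σ = σ₀ ∧ Resumable M D R G t s σ

/-- The statement is not about to go wrong, and its next steps are allowed in phase `p`. -/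
def ThreadSafe (M : MoverSpec Var Val) (D : DeclTable F Var Val) (t : Tid) (p : Effect)
    (s : Stmt F Var Val) (σ : Store Var Val) : Prop :=
  (∀ E : Ctx F Var Val, s ≠ E.fill .wrong) ∧
    ∀ a s', SStep D s a s' → p.seq (a.eff M t σ) ≠ Effect.E

variable {R G : Pred2 Var Val} {t : Tid} {p : Effect} {s s' : Stmt F Var Val}
  {σ₀ σ σ' : Store Var Val} {a : Label Var Val}

theorem Running.seq_eff_ne_error (hB : BodiesTyped M D)
    (h : Running M D R G t p σ₀ s σ) (hs : SStep D s a s') :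
    p.seq (a.eff M t σ) ≠ Effect.E := by
  obtain ⟨P, Q, e, hty, -, he, hP⟩ := h
  obtain ⟨P', e', -, hle, -⟩ := hty.preservation hB hs hP
  refine Effect.ne_error_of_seq_ne_error (b := e') ?_
  rw [Effect.seq_assoc]
  exact Effect.ne_error_of_le (Effect.seq_mono le_rfl hle) he

theorem Running.step (hB : BodiesTyped M D) (h : Running M D R G t p σ₀ s σ)
    (hs : SStep D s a s') (ha : a ≠ .yld) (hr : a.rel t σ σ') :
    Running M D R G t (p.seq (a.eff M t σ)) σ₀ s' σ' := by
  obtain ⟨P, Q, e, hty, hQ, he, hP⟩ := h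
  obtain ⟨P', e', hty', hle, hadv⟩ := hty.preservation hB hs hP
  refine ⟨P', Q, e', hty', hQ, ?_, hadv _ _ (a.advance_of_rel ha hr)⟩
  rw [Effect.seq_assoc]
  exact Effect.ne_error_of_le (Effect.seq_mono le_rfl hle) he

theorem Running.not_wrong (h : Running M D R G t p σ₀ s σ) (E : Ctx F Var Val) :
    s ≠ E.fill .wrong := by
  rintro rfl
  obtain ⟨P, Q, e, hty, -, -, hP⟩ := h
  exact hty.not_wrong hP

theorem Running.threadSafe (hB : BodiesTyped M D) (h : Running M D R G t p σ₀ s σ) :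
    ThreadSafe M D t p s σ :=
  ⟨h.not_wrong, fun _ _ hs => h.seq_eff_ne_error hB hs⟩

/-- A finished transaction is a single step of the guarantee: by `Q ⊆ G` at termination, by the
premise of the yield rule otherwise. -/
theorem Running.resumable (hp : p.IsPhase) (h : Running M D R G t p σ₀ s σ) (hs : s.Idle D) :
    (t, σ₀, σ) ∈ G ∧ Resumable M D R G t s σ := by
  obtain ⟨P, Q, e, hty, hQ, he, hP⟩ := h
  rcases hs with rfl | ⟨s', hs⟩
  · cases hty with
    | skip _ _ _ hPQ => exact ⟨hQ (hPQ hP), .inl rfl⟩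
  · exact ⟨hty.mem_guarantee hs rfl hP,
      .inr ⟨⟨s', hs⟩, P, Q, e, σ₀, σ, hty, hQ, hp.ne_error_of_seq he, hP, .refl⟩⟩

theorem Running.exists_idle (hB : BodiesTyped M D)
    (h : Running M D R G t Effect.N σ₀ s σ) :
    ∃ s' σ', Relation.ReflTransGen (LeftStep M D t) (s, σ) (s', σ') ∧
      Running M D R G t Effect.N σ₀ s' σ' ∧ s'.Idle D := by
  have hrun : ∀ c c', Relation.ReflTransGen (LeftStep M D t) c c' →
      Running M D R G t Effect.N σ₀ c.1 c.2 → Running M D R G t Effect.N σ₀ c'.1 c'.2 := by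
    intro c c' hcc hc
    induction hcc with
    | refl => exact hc
    | tail _ hstep ih =>
      obtain ⟨a, hs, ha, hr, he⟩ := hstep
      have := ih.step hB hs ha hr
      rwa [Effect.nonMover_seq_eq (Label.eff_ne_yield ha) he] at this
  obtain ⟨P, Q, e, hty, hQ, he, hP⟩ := h
  obtain ⟨s', σ', hss, hend⟩ := hty.exists_idle (Effect.nonMover_seq_ne_error.mp he) hP
  exact ⟨s', σ', hss, hrun _ _ hss ⟨P, Q, e, hty, hQ, he, hP⟩,
    hend.elim .inr fun h => .inl h.1⟩

theorem Resumable.idle (h : Resumable M D R G t s σ) : s.Idle D :=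
  h.imp_right And.left

theorem Resumable.step (hB : BodiesTyped M D) (h : Resumable M D R G t s σ)
    (hs : SStep D s a s') : a = .yld ∧ Running M D R G t Effect.R σ s' σ := by
  obtain rfl := h.idle.label_eq_yld hs
  refine ⟨rfl, ?_⟩
  rcases h with rfl | ⟨-, P, Q, e, σ₀, σ₁, hty, hQ, he, hP, hR⟩
  · cases hs
  · obtain ⟨P', e', hty', hle, hadv⟩ := hty.preservation hB hs hP
    refine ⟨P', Q, e', hty', hQ, ?_, hadv _ _ ⟨rfl, hR⟩⟩
    -- Since `R; Y = R`, the yield leaves the thread in phase `R`.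
    have hphase : Effect.R.seq (Effect.Y.seq e') ≠ Effect.E :=
      Effect.ne_error_of_le (Effect.seq_mono le_rfl hle) (Effect.right_seq_ne_error he)
    rwa [← Effect.seq_assoc] at hphase

theorem Resumable.not_wrong (h : Resumable M D R G t s σ) (E : Ctx F Var Val) :
    s ≠ E.fill .wrong := by
  rintro rfl
  rcases h with h | ⟨-, P, Q, e, σ₀, σ₁, hty, -, -, hP, -⟩
  · cases E <;> cases h
  · exact hty.not_wrong hP

/-- This is why `Resumable` has the closure of `R` built in. -/
theorem Resumable.rely (h : Resumable M D R G t s σ) (hR : (t, σ, σ') ∈ R) :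
    Resumable M D R G t s σ' := by
  refine h.imp_right fun ⟨hs, P, Q, e, σ₀, σ₁, hty, hQ, he, hP, h⟩ => ?_
  exact ⟨hs, P, Q, e, σ₀, σ₁, hty, hQ, he, hP, h.tail hR⟩

theorem Active.threadSafe (hB : BodiesTyped M D) (h : Active M D R G t p σ₀ s σ) :
    ThreadSafe M D t p s σ := by
  rcases h with ⟨h, -⟩ | ⟨rfl, rfl, h⟩
  · exact h.threadSafe hB
  · refine ⟨h.not_wrong, fun a s' hs => ?_⟩
    obtain ⟨rfl, -⟩ := h.step hB hs
    exact nofun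

theorem Active.step (hB : BodiesTyped M D) (h : Active M D R G t p σ₀ s σ)
    (hs : SStep D s a s') (hr : a.rel t σ σ') :
    Running M D R G t (p.seq (a.eff M t σ)) σ₀ s' σ' := by
  rcases h with ⟨h, hi⟩ | ⟨rfl, rfl, h⟩
  · refine h.step hB hs ?_ hr
    rintro rfl
    exact hi (.inr ⟨s', hs⟩)
  · obtain ⟨rfl, hrun⟩ := h.step hB hs
    cases hr
    exact hrun

theorem ThreadSafe.of_phase (hp : p.IsPhase) (h : ThreadSafe M D t p s σ) :
    ThreadSafe M D t Effect.R s σ :=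
  ⟨h.1, fun a s' hs => Effect.right_seq_ne_error (hp.ne_error_of_seq (h.2 a s' hs))⟩

theorem ThreadSafe.eff_le (h : ThreadSafe M D t Effect.R s σ) (hs : SStep D s a s') :
    a.eff M t σ ≤ Effect.N :=
  Effect.le_nonMover_of_ne_error (Effect.IsPhase.ne_error_of_seq (.inl rfl) (h.2 a s' hs))

theorem ThreadSafe.congr (h : ThreadSafe M D t p s σ)
    (heff : ∀ a : Label Var Val, a.eff M t σ' = a.eff M t σ) : ThreadSafe M D t p s σ' :=
  ⟨h.1, fun a s' hs => (heff a).symm ▸ h.2 a s' hs⟩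

/-! Executions -/

/-- Replace the statement of thread `i` and the store. -/
def State.set (X : State F Var Val n) (i : Fin n) (s : Stmt F Var Val) (σ : Store Var Val) :
    State F Var Val n :=
  ⟨Function.update X.threads i s, σ⟩

theorem State.set_threads_self (X : State F Var Val n) (i : Fin n) (s : Stmt F Var Val)
    (σ : Store Var Val) : (X.set i s σ).threads i = s :=
  Function.update_self ..

theorem State.set_threads_of_ne (X : State F Var Val n) {i j : Fin n} (h : j ≠ i)
    (s : Stmt F Var Val) (σ : Store Var Val) : (X.set i s σ).threads j = X.threads j :=
  Function.update_of_ne h ..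

theorem State.set_comm (X : State F Var Val n) {i j : Fin n} (h : i ≠ j)
    (s s' : Stmt F Var Val) (σ σ' τ : Store Var Val) :
    (X.set i s σ).set j s' τ = (X.set j s' σ').set i s τ :=
  congrArg (State.mk · τ) (Function.update_comm h ..)

theorem State.set_set (X : State F Var Val n) (i : Fin n) (s s' : Stmt F Var Val)
    (σ σ' : Store Var Val) : (X.set i s σ).set i s' σ' = X.set i s' σ' :=
  congrArg (State.mk · σ') (Function.update_idem ..)

theorem State.set_self (X : State F Var Val n) (i : Fin n) :
    X.set i (X.threads i) X.store = X :=
  congrArg (State.mk · X.store) (Function.update_eq_self ..)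

theorem tid_injective : Function.Injective (tid : Fin n → Tid) :=
  fun _ _ h => Fin.ext (Nat.succPNat_injective h)

/-- Executions of a given length. -/
inductive Exec (D : DeclTable F Var Val) : ℕ → State F Var Val n → State F Var Val n → Prop
  | refl (X : State F Var Val n) : Exec D 0 X X
  | cons {k : ℕ} {X Y : State F Var Val n} (i : Fin n) (a : Label Var Val) (s : Stmt F Var Val)
      (σ : Store Var Val) (hs : SStep D (X.threads i) a s) (hr : a.rel (tid i) X.store σ)
      (h : Exec D k (X.set i s σ) Y) : Exec D (k + 1) X Y

theorem exists_exec {X Y : State F Var Val n} (h : Relation.ReflTransGen (Step D) X Y) :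
    ∃ k, Exec D k X Y := by
  induction h using Relation.ReflTransGen.head_induction_on with
  | refl => exact ⟨0, .refl _⟩
  | head h _ ih =>
    obtain ⟨k, ih⟩ := ih
    cases h with
    | thread i s' σ' h =>
      obtain ⟨a, hs, hr⟩ := h.exists_sstep
      exact ⟨k + 1, .cons i a s' σ' hs hr ih⟩

/-- Executions of a given length of the threads other than `c`, with effects up to `b`. -/
inductive OtherExec (M : MoverSpec Var Val) (D : DeclTable F Var Val) (b : Effect) (c : Fin n) :
    ℕ → State F Var Val n → State F Var Val n → Prop
  | refl (X : State F Var Val n) : OtherExec M D b c 0 X X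
  | snoc {k : ℕ} {X Y : State F Var Val n} (i : Fin n) (a : Label Var Val) (s : Stmt F Var Val)
      (σ : Store Var Val) (h : OtherExec M D b c k X Y) (hi : i ≠ c)
      (hs : SStep D (Y.threads i) a s) (hr : a.rel (tid i) Y.store σ)
      (he : a.eff M (tid i) Y.store ≤ b) : OtherExec M D b c (k + 1) X (Y.set i s σ)

variable {b b' : Effect} {c : Fin n} {k m : ℕ} {X Y Z : State F Var Val n}

theorem OtherExec.mono (h : OtherExec M D b c k X Y) (hb : b ≤ b') :
    OtherExec M D b' c k X Y := by
  induction h with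
  | refl => exact .refl _
  | snoc i a s σ _ hi hs hr he ih => exact .snoc i a s σ ih hi hs hr (he.trans hb)

theorem OtherExec.append (h : OtherExec M D b c k X Y) (h' : Exec D m Y Z) :
    Exec D (k + m) X Z := by
  induction h generalizing m with
  | refl => rwa [Nat.zero_add]
  | snoc i a s σ _ _ hs hr _ ih =>
    rw [Nat.add_right_comm, Nat.add_assoc]
    exact ih (.cons i a s σ hs hr h')

theorem OtherExec.threads_eq (h : OtherExec M D b c k X Y) : Y.threads c = X.threads c := by
  induction h with
  | refl => rfl
  | snoc i a s σ _ hi _ _ _ ih => rw [State.set_threads_of_ne _ hi.symm, ih]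

theorem OtherExec.eff_eq (hM : M.Valid) (hb : b ≤ Effect.N) (h : OtherExec M D b c k X Y)
    (a : Label Var Val) : a.eff M (tid c) Y.store = a.eff M (tid c) X.store := by
  induction h with
  | refl => rfl
  | snoc i a' s σ _ hi _ hr he ih =>
    exact (hM.eff_stable (tid_injective.ne hi) a (he.trans hb) hr).trans ih

/-- A step of thread `c` moves to the left of an execution of the other threads. -/
theorem OtherExec.moveLeft (hM : M.Valid) (h : OtherExec M D b c k X Y)
    (hr : a.rel (tid c) Y.store σ) (hb : b.Swappable (a.eff M (tid c) X.store))
    (s : Stmt F Var Val) :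
    ∃ τ, a.rel (tid c) X.store τ ∧ OtherExec M D b c k (X.set c s τ) (Y.set c s σ) := by
  induction h generalizing σ with
  | refl => exact ⟨σ, hr, .refl _⟩
  | @snoc k X Y i a' s' σ' h hi hs' hr' he' ih =>
    have hstable := hM.eff_stable (tid_injective.ne hi) a (he'.trans hb.left_le) hr'
    have heff := h.eff_eq hM hb.left_le a
    obtain ⟨σ'', h₁, h₂⟩ := hM.swap (tid_injective.ne hi) hr' hr (by
      rw [hstable, heff]
      exact hb.imp (And.imp_left he'.trans) (And.imp_left he'.trans))
    obtain ⟨τ, hτ, hrun⟩ := ih h₁ hb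
    refine ⟨τ, hτ, ?_⟩
    rw [State.set_comm Y hi s' s σ' σ'' σ]
    refine .snoc i a' s' σ hrun hi ?_ h₂ ?_
    · rwa [State.set_threads_of_ne _ hi]
    -- The step of thread `i` now comes after that of `c`; by stability its effect is still bounded
    -- by `b`.
    · refine le_of_eq_of_le (hM.eff_stable (tid_injective.ne hi.symm) a' ?_ h₁) he'
      rw [heff]
      exact hb.right_le

/-- A left mover of thread `c` is still possible after an execution of the other threads. -/
theorem OtherExec.push (hM : M.Valid) (hb : b ≤ Effect.N) (h : OtherExec M D b c k X Y)
    (hr : a.rel (tid c) X.store σ) (he : a.eff M (tid c) X.store ≤ Effect.L)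
    (s : Stmt F Var Val) :
    ∃ τ, a.rel (tid c) Y.store τ ∧ OtherExec M D b c k (X.set c s σ) (Y.set c s τ) := by
  induction h with
  | refl => exact ⟨σ, hr, .refl _⟩
  | @snoc k X Y i a' s' σ' h hi hs' hr' he' ih =>
    obtain ⟨τ, hτ, hrun⟩ := ih hr he
    have heff := h.eff_eq hM hb a
    obtain ⟨τ', h₁, h₂⟩ := hM.diamond (tid_injective.ne hi) hr' hτ (he'.trans hb) (heff ▸ he)
    refine ⟨τ', h₁, ?_⟩
    rw [State.set_comm Y hi s' s σ' τ τ']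
    refine .snoc i a' s' τ' hrun hi ?_ h₂ ?_
    · rwa [State.set_threads_of_ne _ hi]
    · refine le_of_eq_of_le (hM.eff_stable (tid_injective.ne hi.symm) a' ?_ hτ) he'
      rw [heff]
      exact he.trans (by decide)

/-- The other threads make the same steps whether `c` performs its left movers before or after them.
The second conjunct carries safety back from the store where `c` has finished. -/
theorem OtherExec.push_run (hM : M.Valid) (hb : b ≤ Effect.N)
    (hrun : Relation.ReflTransGen (LeftStep M D (tid c)) (s, σ) (s', σ'))
    (h : OtherExec M D b c k (X.set c s σ) Y) :
    ∃ τ, OtherExec M D b c k (X.set c s' σ') (Y.set c s' τ) ∧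
      ∀ i ≠ c, ∀ a : Label Var Val, a.eff M (tid i) τ = a.eff M (tid i) Y.store := by
  generalize hc : (s', σ') = d at hrun
  induction hrun generalizing s' σ' with
  | refl =>
    cases hc
    have hY := h.threads_eq
    rw [State.set_threads_self] at hY
    refine ⟨Y.store, ?_, fun _ _ _ => rfl⟩
    rwa [← hY, State.set_self, hY]
  | @tail d d' _ hstep ih =>
    subst hc
    obtain ⟨a, hs, ha, hr, he⟩ := hstep
    obtain ⟨τ, hτ, hstable⟩ := ih rfl
    obtain ⟨τ', hr', hτ'⟩ := hτ.push hM hb hr he s'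
    rw [State.set_set, State.set_set] at hτ'
    refine ⟨τ', hτ', fun i hi a' => (hM.eff_stable (tid_injective.ne hi.symm) a' ?_ hr').trans
      (hstable i hi a')⟩
    exact le_of_eq_of_le (hτ.eff_eq hM hb a) (he.trans (by decide))

/-! Reduction -/

/-- All threads are between transactions. -/
def AllResumable (M : MoverSpec Var Val) (D : DeclTable F Var Val) (R G : Pred2 Var Val)
    (X : State F Var Val n) : Prop :=
  ∀ i, Resumable M D R G (tid i) (X.threads i) X.store

/-- No thread is about to go wrong or to execute an action with the error effect. -/
def StateSafe (M : MoverSpec Var Val) (D : DeclTable F Var Val) (X : State F Var Val n) : Prop :=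
  ∀ i, ThreadSafe M D (tid i) Effect.R (X.threads i) X.store

/-- The guarantee of each thread implies the rely of the others. -/
def Compatible (n : ℕ) (R G : Pred2 Var Val) : Prop :=
  ∀ i j : Fin n, i ≠ j → ∀ σ σ', (tid i, σ, σ') ∈ G → (tid j, σ, σ') ∈ R

theorem AllResumable.set (hRG : Compatible n R G) (hX : AllResumable M D R G X)
    (hp : p.IsPhase) (h : Running M D R G (tid c) p X.store s σ) (hs : s.Idle D) :
    AllResumable M D R G (X.set c s σ) := by
  obtain ⟨hG, hres⟩ := h.resumable hp hs
  intro i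
  by_cases hi : i = c
  · subst hi
    rwa [State.set_threads_self]
  · rw [State.set_threads_of_ne _ hi]
    exact (hX i).rely (hRG c i (Ne.symm hi) _ _ hG)

/-- Executions shorter than `k` from states in which all threads are between transactions are
safe. -/
def SafeBelow (M : MoverSpec Var Val) (D : DeclTable F Var Val) (R G : Pred2 Var Val)
    (n k : ℕ) : Prop :=
  ∀ m < k, ∀ X Y : State F Var Val n, AllResumable M D R G X → Exec D m X Y → StateSafe M D Y

/-- The case where the execution stops in mid-transaction. The thread `c` is safe by its own typing.
For the others, `c` is run to the end of its transaction; these extra steps precede the new starting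
state, so the execution given to the induction hypothesis has only the `m` steps of the others. -/
theorem stateSafe_of_committed (hM : M.Valid) (hB : BodiesTyped M D) (hRG : Compatible n R G)
    (ih : SafeBelow M D R G n k) (hX : AllResumable M D R G X)
    (hrun : Running M D R G (tid c) Effect.N X.store s σ)
    (hother : OtherExec M D Effect.N c m (X.set c s σ) Y) (hm : m < k) : StateSafe M D Y := by
  intro i
  by_cases hi : i = c
  · subst hi
    rw [hother.threads_eq, State.set_threads_self]
    exact ((hrun.threadSafe hB).congr (hother.eff_eq hM le_rfl)).of_phase (.inr rfl)
  · obtain ⟨s', σ', hsteps, hrun', hidle⟩ := hrun.exists_idle hB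
    obtain ⟨τ, hother', hstable⟩ := hother.push_run hM le_rfl hsteps
    have hsafe := ih m hm _ _ (hX.set hRG (.inr rfl) hrun' hidle) (hother'.append (.refl _)) i
    rw [State.set_threads_of_ne _ hi] at hsafe
    exact hsafe.congr fun a => (hstable i hi a).symm

theorem stateSafe_of_exec_committed (hM : M.Valid) (hB : BodiesTyped M D)
    (hRG : Compatible n R G) (ih : SafeBelow M D R G n k) (hX : AllResumable M D R G X)
    (hexec : Exec D m Y Z) {q : ℕ} {s : Stmt F Var Val} {σ : Store Var Val}
    (hrun : Running M D R G (tid c) Effect.N X.store s σ) (hs : ¬ s.Idle D)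
    (hother : OtherExec M D Effect.N c q (X.set c s σ) Y) (hqm : q + m < k) :
    StateSafe M D Z := by
  induction hexec generalizing q s σ with
  | refl => exact stateSafe_of_committed hM hB hRG ih hX hrun hother hqm
  | @cons m Y Z i a s' σ' hstep hr hexec ih' =>
    by_cases hi : i = c
    · subst hi
      rw [hother.threads_eq, State.set_threads_self] at hstep
      have hne := hrun.seq_eff_ne_error hB hstep
      have ha : a ≠ .yld := by
        rintro rfl
        exact hs (.inr ⟨s', hstep⟩)
      have hL := Effect.nonMover_seq_ne_error.mp hne
      -- After the commit point every step of `c` is a left mover and joins the front.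
      obtain ⟨τ, hτ, hother'⟩ := hother.moveLeft hM hr (.inr ⟨le_rfl, hL⟩) s'
      rw [State.set_set] at hother'
      have hrun' := hrun.step hB hstep ha hτ
      rw [Effect.nonMover_seq_eq (Label.eff_ne_yield ha) hL] at hrun'
      by_cases hidle : s'.Idle D
      · exact ih (q + m) (by omega) _ _ (hX.set hRG (.inr rfl) hrun' hidle)
          (hother'.append hexec)
      · exact ih' hrun' hidle hother' (by omega)
    -- Safety of the present state bounds the effect of the next step by `N`, as `OtherExec`
    -- requires.
    · have hsafe := stateSafe_of_committed hM hB hRG ih hX hrun hother (by omega)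
      exact ih' hrun hs (.snoc i a s' σ' hother hi hstep hr ((hsafe i).eff_le hstep)) (by omega)

/-- No transaction that is under way in `Y` has committed; each of them could have been executed
first, from `X`. At most `j` steps lead from `X` to `Y`. -/
def Uncommitted (M : MoverSpec Var Val) (D : DeclTable F Var Val) (R G : Pred2 Var Val)
    (j : ℕ) (X Y : State F Var Val n) : Prop :=
  ∀ i, ∃ τ, ∃ q ≤ j, Active M D R G (tid i) Effect.R X.store (Y.threads i) τ ∧
    OtherExec M D Effect.R i q (X.set i (Y.threads i) τ) Y

theorem AllResumable.uncommitted (hX : AllResumable M D R G X) : Uncommitted M D R G 0 X X :=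
  fun i => ⟨X.store, 0, le_rfl, .inr ⟨rfl, rfl, hX i⟩, by
    rw [State.set_self]
    exact .refl X⟩

theorem Uncommitted.stateSafe (hM : M.Valid) (hB : BodiesTyped M D) {j : ℕ}
    (h : Uncommitted M D R G j X Y) : StateSafe M D Y := by
  intro i
  obtain ⟨τ, q, -, hact, hother⟩ := h i
  exact (hact.threadSafe hB).congr (hother.eff_eq hM (by decide))

theorem stateSafe_of_exec_uncommitted (hM : M.Valid) (hB : BodiesTyped M D)
    (hRG : Compatible n R G) (ih : SafeBelow M D R G n k) (hX : AllResumable M D R G X)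
    (hexec : Exec D m Y Z) {j : ℕ} (hY : Uncommitted M D R G j X Y) (hjm : j + m ≤ k) :
    StateSafe M D Z := by
  induction hexec generalizing j with
  | refl => exact hY.stateSafe hM hB
  | @cons m Y Z i a s σ hstep hr hexec ih' =>
    obtain ⟨τ, q, hq, hact, hother⟩ := hY i
    have hN : a.eff M (tid i) τ ≤ Effect.N := (hact.threadSafe hB).eff_le hstep
    obtain ⟨τ', hτ', hother'⟩ := hother.moveLeft hM hr (.inl ⟨le_rfl, hN⟩) s
    rw [State.set_set] at hother'
    have hne : Effect.R.seq (a.eff M (tid i) τ) ≠ Effect.E :=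
      (hact.threadSafe hB).2 _ _ hstep
    have hrun := hact.step hB hstep hτ'
    have hphase : (Effect.R.seq (a.eff M (tid i) τ)).IsPhase := Effect.IsPhase.seq (.inl rfl) hne
    by_cases hidle : s.Idle D
    -- The step just taken belongs to the finished transaction and is no longer counted: `q ≤ j` and
    -- `j + (m + 1) ≤ k` give `q + m < k`.
    · exact ih (q + m) (by omega) _ _ (hX.set hRG hphase hrun hidle) (hother'.append hexec)
    · rcases hphase with hR | hN
      · rw [hR] at hrun
        rw [Effect.right_seq_eq_right] at hR
        refine ih' (j := j + 1) (fun l => ?_) (by omega)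
        by_cases hl : l = i
        · subst hl
          rw [State.set_threads_self]
          exact ⟨τ', q, by omega, .inl ⟨hrun, hidle⟩, hother'⟩
        -- Seen from another thread `l`, the step of `i` is one more right mover at the end.
        · obtain ⟨ρ, r, hr', hactl, hotherl⟩ := hY l
          rw [State.set_threads_of_ne _ hl]
          refine ⟨ρ, r + 1, by omega, hactl, .snoc i a s σ hotherl (Ne.symm hl) hstep hr ?_⟩
          rwa [show a.eff M (tid i) Y.store = a.eff M (tid i) τ from
            hother.eff_eq hM (by decide) a]
      · rw [hN] at hrun
        exact stateSafe_of_exec_committed hM hB hRG ih hX hexec hrun hidle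
          (hother'.mono (by decide)) (by omega)

theorem safeBelow (hM : M.Valid) (hB : BodiesTyped M D) (hRG : Compatible n R G) (k : ℕ) :
    SafeBelow M D R G n k := by
  induction k with
  | zero => exact fun m hm => absurd hm (Nat.not_lt_zero m)
  | succ k ih =>
    intro m hm X Y hX hexec
    exact stateSafe_of_exec_uncommitted hM hB hRG ih hX hexec hX.uncommitted (by omega)

theorem StateJudgment.not_goesWrong (h : StateJudgment M D X) : ¬ GoesWrong D X := by
  rintro ⟨Y, hXY, i, E, hwrong⟩
  obtain ⟨R, G, P, Q, e, hfn, hM, -, hthread, hRG⟩ := h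
  obtain ⟨k, hexec⟩ := exists_exec hXY
  refine (safeBelow hM (bodiesTyped_of_fnJudgment hfn) hRG (k + 1) k k.lt_succ_self X Y
    (fun i => ?_) hexec i).1 E hwrong
  obtain ⟨hty, he, hQ, hy, hP⟩ := hthread i
  exact .inr ⟨hy.exists_sstep D, P i, Q i, e i, _, _, hty.typing_of_fnJudgment hfn, hQ, he, hP,
    .refl⟩

end MoverLogic

theorem theorem1 {F Var Val : Type*} {n : ℕ}
    (M : MoverLogic.MoverSpec Var Val) (D : MoverLogic.DeclTable F Var Val)
    (X : MoverLogic.State F Var Val n) (h : MoverLogic.StateJudgment M D X) :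
    ¬ MoverLogic.GoesWrong D X :=
  h.not_goesWrong
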